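/- **Theorem (Global convergence).** Let $d\ge 0$, $d_3\ge1$, and equip $\mathbb{R}^{d\times d\times d_3}$ with the Frobenius inner product and norm. For a tensor $\mathcal T$ let $\widetilde{\mathcal T}^{(j)}$, $j=1,\dots,d_3$, be the frontal slices of its discrete Fourier transform along the third dimension, and let $\sigma_{1j}(\mathcal T)\ge\dots\ge\sigma_{dj}(\mathcal T)\ge0$ be the singular values of $\widetilde{\mathcal T}^{(j)}$. Let $\partial$ denote the limiting subdifferential; a point $\mathcal B$ is stationary for a function $f$ if $0\in\partial f(\mathcal B)$. *Objective.* Let $\rho_\lambda:\mathbb{R}\to\mathbb{R}$ be even with $\rho_\lambda(0)=0$; nonnegative, continuous, concave and nondecreasing on $[0,\infty)$; such that $x\mapsto\rho_\lambda(x)/x$ is nonincreasing on $(0,\infty)$; differentiable at every $x\ne0$, with $\partial\rho_\lambda(0)\neq\emptyset$ and $\lim_{x\to0^+}\rho_\lambda'(x)$ existing in $\mathbb{R}$; and such that $\rho_\lambda(x)+\frac{\mu}{2}x^2$ is convex on $\mathbb{R}$ for some $\mu>0$. Put $\rho_\lambda(\mathcal B)=\frac1{d_3}\sum_{i=1}^d\sum_{j=1}^{d_3}\rho_\lambda(\sigma_{ij}(\mathcal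 B))$. Let $L_n:\mathbb{R}^{d\times d\times d_3}\to\mathbb{R}$ be differentiable with $L_n'$ Lipschitz continuous with constant $C_l>0$, and let $F=L_n+\rho_\lambda$. *Algorithm.* Let $\kappa>1$, $0<\alpha<1$, $\eta_0^{(0)}>0$, $\eta_{\min}\in\mathbb{R}$, and let $\mathcal B_0$ be arbitrary. In iteration $k\ge0$ choose weights $w_{ij,k}\in\partial\rho_\lambda(\sigma_{ij}(\mathcal B_k))$ for which $\rho_\lambda(s)\le\rho_\lambda(\sigma_{ij}(\mathcal B_k))+w_{ij,k}(s-\sigma_{ij}(\mathcal B_k))$ for all $s\ge0$ (that is, $w_{ij,k}=\rho_\lambda'(\sigma_{ij}(\mathcal B_k))$ if $\sigma_{ij}(\mathcal B_k)>0$, and $w_{ij,k}=\lim_{x\to0^+}\rho_\lambda'(x)$ otherwise). For a trial value $\eta$, compute a real tensor $\mathcal X$ by weighted tensor singular value thresholding: with $\mathcal G=\mathcal B_k-\frac1\eta L_n'(\mathcal B_k)$ and singular value decompositions $\widetilde{\mathcal G}^{(j)}=U_j\,\mathrm{diag}(\sigma_{ij}(\mathcal G))_i\,V_j^{\mathsf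 H}$, $$\widetilde{\mathcal X}^{(j)}=U_j\,\mathrm{diag}\big(\max\{\sigma_{ij}(\mathcal G)-\tfrac{1}{\eta}w_{ij,k},\,0\}\big)_i\,V_j^{\mathsf H},\qquad j=1,\dots,d_3 .$$ The trial is accepted if $$F(\mathcal X)+\tfrac{\alpha}{2}\eta\|\mathcal X-\mathcal B_k\|_F^2\le F(\mathcal B_k).$$ The trial values are $\eta_k^{(0)},\kappa\eta_k^{(0)},\kappa^2\eta_k^{(0)},\dots$; the first accepted one is called $\eta_k$, and $\mathcal B_{k+1}$ is the corresponding $\mathcal X$. For $k\ge1$ the first trial value is the (safeguarded) Barzilai–Borwein value $$\eta_k^{(0)}=\max\Big\{\frac{\langle\Delta_{1k},\Delta_{2k}\rangle}{\langle\Delta_{1k},\Delta_{1k}\rangle},\ \eta_{\min}\Big\},\qquad \Delta_{1k}=\mathcal B_k-\mathcal B_{k-1},\quad \Delta_{2k}=L_n'(\mathcal B_k)-L_n'(\mathcal B_{k-1}),$$ (any $\eta_{\min}\le -C_l$ gives the plain Barzilai–Borwein rule). If $\mathcal B_{k+1}=\mathcal B_k$, the algorithm stops and the sequence is continued as a constant.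 *Claim.* Assume that $\eta_k\ge C_l/(1-\alpha)$ for all $k>0$, that $F$ is coercive (bounded below, and $F(\mathcal B)\to\infty$ as $\|\mathcal B\|_F\to\infty$), and that $F$ is a Kurdyka–Łojasiewicz function, i.e. for every $\bar{\mathcal B}$ with $\partial F(\bar{\mathcal B})\ne\emptyset$ there are $r>0$, a neighbourhood $N$ of $\bar{\mathcal B}$ and a continuous concave $\varphi:[0,r)\to[0,\infty)$ with $\varphi(0)=0$, $\varphi\in C^1(0,r)$, $\varphi'>0$ on $(0,r)$, such that $\varphi'(F(\mathcal B)-F(\bar{\mathcal B}))\,\mathrm{dist}(0,\partial F(\mathcal B))\ge1$ for all $\mathcal B\in N$ with $F(\bar{\mathcal B})<F(\mathcal B)<F(\bar{\mathcal B})+r$. Then every sequence $\{\mathcal B_k\}$ generated by the algorithm converges to a stationary point of $F$ and has finite length: $\sum_{k=0}^{\infty}\|\mathcal B_{k+1}-\mathcal B_k\|_F<\infty$ and $\sum_{k=0}^{\infty}\|\mathcal B_{k+1}-\mathcal B_k\|_F^2<\infty$. -/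

import Mathlib

open Filter Topology

noncomputable section

namespace TensorReg

/-! ### Subdifferentials, coercivity, the Kurdyka-Lojasiewicz property -/

section Variational

variable {E : Type*} [NormedAddCommGroup E] [InnerProductSpace ℝ E]

/-- The regular (Frechet) subdifferential: all `v` with
`f y ≥ f x + ⟪v, y - x⟫ - o(‖y - x‖)` as `y → x`. -/
def frechetSubdiff (f : E → ℝ) (x : E) : Set E :=
  {v | ∀ ε : ℝ, 0 < ε → ∀ᶠ y in 𝓝 x, f x + inner ℝ v (y - x) - ε * ‖y - x‖ ≤ f y}

/-- The (limiting) subdifferential: limits of regular subgradients `v n` at points `u n → x`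
with `f (u n) → f x`. -/
def subdiff (f : E → ℝ) (x : E) : Set E :=
  {v | ∃ (u w : ℕ → E), Tendsto u atTop (𝓝 x) ∧ Tendsto (fun n => f (u n)) atTop (𝓝 (f x)) ∧
    (∀ n, w n ∈ frechetSubdiff f (u n)) ∧ Tendsto w atTop (𝓝 v)}

/-- Stationary points: `0 ∈ ∂f(x)`. -/
def IsStationary (f : E → ℝ) (x : E) : Prop := (0 : E) ∈ subdiff f x

/-- Coercive: bounded from below, and `f x → ∞` as `‖x‖ → ∞`. -/
def IsCoercive (f : E → ℝ) : Prop :=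
  BddBelow (Set.range f) ∧ Tendsto f (Bornology.cobounded E) atTop

/-- A desingularizing function on `[0, r)`. -/
structure IsDesingularizing (r : ℝ) (φ : ℝ → ℝ) : Prop where
  map_zero : φ 0 = 0
  continuousOn : ContinuousOn φ (Set.Ico 0 r)
  concaveOn : ConcaveOn ℝ (Set.Ico 0 r) φ
  contDiffOn : ContDiffOn ℝ 1 φ (Set.Ioo 0 r)
  deriv_pos : ∀ s ∈ Set.Ioo 0 r, 0 < deriv φ s

/-- The KL property at `x`: near `x`, on `{f x < f < f x + r}`, one has
`φ'(f y - f x) * dist(0, ∂f(y)) ≥ 1`. The distance is written out over the subgradients, so that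
it is infinite when there are none. -/
def HasKL (f : E → ℝ) (x : E) : Prop :=
  ∃ r : ℝ, 0 < r ∧ ∃ φ : ℝ → ℝ, IsDesingularizing r φ ∧
    ∀ᶠ y in 𝓝 x, f x < f y → f y < f x + r →
      ∀ v ∈ subdiff f y, 1 ≤ deriv φ (f y - f x) * ‖v‖

/-- KL functions: the KL property holds at every point of the domain of the subdifferential. -/
def IsKL (f : E → ℝ) : Prop := ∀ x, (subdiff f x).Nonempty → HasKL f x

end Variational

/-! ### Tensors, singular values in the Fourier domain, the penalty -/

/-- Real `d × d × d₃` tensors with the Frobenius inner product and norm; the third index is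
taken modulo `d₃`. -/
abbrev Tensor (d d₃ : ℕ) [NeZero d₃] : Type :=
  EuclideanSpace ℝ (Fin d × Fin d × ZMod d₃)

variable {d d₃ : ℕ} [NeZero d₃]

/-- The `j`-th frontal slice of the discrete Fourier transform of `T` along its third
dimension. -/
def fourierSlice (T : Tensor d d₃) (j : ZMod d₃) : Matrix (Fin d) (Fin d) ℂ :=
  ZMod.dft (fun k => Matrix.of fun a b => ((T (a, b, k) : ℝ) : ℂ)) j

/-- The singular values `σ_{ij}` of `T`: `σ_{1j} ≥ ⋯ ≥ σ_{dj} ≥ 0` are the singular values of the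
`j`-th frontal slice in the Fourier domain. -/
def sv (T : Tensor d d₃) (i : Fin d) (j : ZMod d₃) : ℝ :=
  (Matrix.toEuclideanLin (fourierSlice T j)).singularValues i

/-- The tensor penalty `ρ(T) = (1 / d₃) ∑ᵢ ∑ⱼ ρ(σ_{ij})`. -/
def tensorPenalty (ρ : ℝ → ℝ) (T : Tensor d d₃) : ℝ :=
  (1 / (d₃ : ℝ)) * ∑ i : Fin d, ∑ j : ZMod d₃, ρ (sv T i j)

/-- The objective function `F = L + ρ`. -/
def objective (L : Tensor d d₃ → ℝ) (ρ : ℝ → ℝ) (T : Tensor d d₃) : ℝ :=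
  L T + tensorPenalty ρ T

/-- The conditions on the scalar penalty: those in the definition of the tensor penalty
(nonnegative, continuous, concave, increasing on the half-line), and the further regularity
assumptions. -/
structure IsPenalty (ρ : ℝ → ℝ) : Prop where
  nonneg : ∀ x, 0 ≤ x → 0 ≤ ρ x
  continuousOn : ContinuousOn ρ (Set.Ici 0)
  concaveOn : ConcaveOn ℝ (Set.Ici 0) ρ
  symm : ∀ x, ρ (-x) = ρ x
  map_zero : ρ 0 = 0
  monotoneOn : MonotoneOn ρ (Set.Ici 0)
  antitoneOn_div : AntitoneOn (fun x => ρ x / x) (Set.Ioi 0)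
  differentiableAt : ∀ x, x ≠ 0 → DifferentiableAt ℝ ρ x
  subdiff_zero_nonempty : (subdiff ρ 0).Nonempty
  deriv_tendsto : ∃ C : ℝ, Tendsto (deriv ρ) (𝓝[>] 0) (𝓝 C)
  weaklyConvex : ∃ μ : ℝ, 0 < μ ∧ ConvexOn ℝ Set.univ (fun x => ρ x + μ / 2 * x ^ 2)

/-! ### The reweighted algorithm -/

/-- `W` is an admissible weight matrix at `T`: `W i j` is a subgradient of `ρ` at `σ_{ij}` for
which the linearization of `ρ` at `σ_{ij}` majorizes `ρ` on the half-line. -/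
def IsWeight (ρ : ℝ → ℝ) (T : Tensor d d₃) (W : Fin d → ZMod d₃ → ℝ) : Prop :=
  ∀ i j, W i j ∈ subdiff ρ (sv T i j) ∧
    ∀ s : ℝ, 0 ≤ s → ρ s ≤ ρ (sv T i j) + W i j * (s - sv T i j)

/-- `X` is obtained from `G` by weighted tensor singular value thresholding with thresholds
`τ i j`: in the Fourier domain, `G⁽ʲ⁾ = U diag(σ_{ij}(G)) Vᴴ` is a singular value decomposition and
`X⁽ʲ⁾ = U diag((σ_{ij}(G) - τ i j)₊) Vᴴ`. -/
def IsWtSVT (G : Tensor d d₃) (τ : Fin d → ZMod d₃ → ℝ) (X : Tensor d d₃) : Prop :=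
  ∀ j : ZMod d₃, ∃ U ∈ Matrix.unitaryGroup (Fin d) ℂ, ∃ V ∈ Matrix.unitaryGroup (Fin d) ℂ,
    fourierSlice G j = U * Matrix.diagonal (fun i => ((sv G i j : ℝ) : ℂ)) * V.conjTranspose ∧
    fourierSlice X j =
      U * Matrix.diagonal (fun i => ((max (sv G i j - τ i j) 0 : ℝ) : ℂ)) * V.conjTranspose

/-- `X` is an update computed from the iterate `T`, the weights `W` and the parameter `η`:
weighted singular value thresholding of `T - L'(T) / η` with thresholds `W i j / η`. -/
def IsUpdate (L : Tensor d d₃ → ℝ) (W : Fin d → ZMod d₃ → ℝ) (η : ℝ) (T X : Tensor d d₃) : Prop :=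
  IsWtSVT (T - (1 / η) • gradient L T) (fun i j => 1 / η * W i j) X

/-- The monotone search criterion. -/
def SearchCriterion (L : Tensor d d₃ → ℝ) (ρ : ℝ → ℝ) (α η : ℝ) (T X : Tensor d d₃) : Prop :=
  objective L ρ X + α / 2 * η * ‖X - T‖ ^ 2 ≤ objective L ρ T

/-- The Barzilai-Borwein value `⟪Δ₁, Δ₂⟫ / ⟪Δ₁, Δ₁⟫` with `Δ₁ = T - S`, `Δ₂ = L'(T) - L'(S)`. -/
def barzilaiBorwein (L : Tensor d d₃ → ℝ) (S T : Tensor d d₃) : ℝ :=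
  inner ℝ (T - S) (gradient L T - gradient L S) / inner ℝ (T - S) (T - S)

/-- The first trial value of `η` in iteration `k`: the input `η₀` for `k = 0`, afterwards the
Barzilai-Borwein value, safeguarded from below by a constant `ηmin`. The plain rule is the case
where `ηmin` does not exceed any of these values (`ηmin = -C` when `L'` is `C`-Lipschitz). -/
def initStep (L : Tensor d d₃ → ℝ) (η₀ ηmin : ℝ) (B : ℕ → Tensor d d₃) : ℕ → ℝ
  | 0 => η₀
  | k + 1 => max (barzilaiBorwein L (B k) (B (k + 1))) ηmin

/-- Iteration `k` with backtracking: the trial values are `κ ^ l * η` for `l = 0, 1, …`, where `η`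
is the first one; the trials `l < m` are rejected, the trial `l = m` is accepted, its value is
`η k` and its update is `B (k + 1)`. -/
def IsIteration (L : Tensor d d₃ → ℝ) (ρ : ℝ → ℝ) (κ α η₀ ηmin : ℝ)
    (B : ℕ → Tensor d d₃) (η : ℕ → ℝ) (k : ℕ) : Prop :=
  ∃ W : Fin d → ZMod d₃ → ℝ, IsWeight ρ (B k) W ∧ ∃ m : ℕ,
    η k = κ ^ m * initStep L η₀ ηmin B k ∧
    IsUpdate L W (η k) (B k) (B (k + 1)) ∧
    SearchCriterion L ρ α (η k) (B k) (B (k + 1)) ∧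
    ∀ l < m, ∃ X, IsUpdate L W (κ ^ l * initStep L η₀ ηmin B k) (B k) X ∧
      ¬ SearchCriterion L ρ α (κ ^ l * initStep L η₀ ηmin B k) (B k) X

/-- `B` and `η` are generated by the algorithm with zero stopping tolerance: it iterates as long
as no two consecutive iterates have coincided; once it has stopped, the sequence stays
constant. -/
def IsGenerated (L : Tensor d d₃ → ℝ) (ρ : ℝ → ℝ) (κ α η₀ ηmin : ℝ)
    (B : ℕ → Tensor d d₃) (η : ℕ → ℝ) : Prop :=
  ∀ k, ((∀ l < k, B (l + 1) ≠ B l) → IsIteration L ρ κ α η₀ ηmin B η k) ∧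
    ((∃ l < k, B (l + 1) = B l) → B (k + 1) = B k)

end TensorReg

end

noncomputable section

namespace TensorReg

/-! The argument is the descent scheme of Attouch, Bolte and Svaiter: sufficient decrease, plus a
subgradient at the new iterate bounded by the last step, plus the Kurdyka-Łojasiewicz property, give
finite length and a stationary limit (`tendsto_stationary_of_descent`).

Decrease is the acceptance test itself, with `η k` bounded below by a positive constant. The
subgradient bound also needs `η k` bounded above. Thresholding minimizes the linearized model, so
every trial with `η ≥ Cl / (1 - α)` passes the test (`IsUpdate.searchCriterion`). Hence the last
rejected trial lies below that value, the accepted one is at most `κ` times larger, and an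
immediately accepted Barzilai-Borwein value is at most `max Cl ηmin` (`IsIteration.step_le`).

The main work is the subgradient at an update `X` (`IsUpdate.exists_frechetSubdiff`). Optimality of
thresholding provides `η (G - X)`, whose singular values at the positive positions of `X` are the
weights taken at the old iterate. Weak convexity makes `ρ'` Lipschitz on the half-line, so replacing
these weights by `ρ'(σ(X))` costs at most `μ ‖X - T‖`. That the corrected object is a subgradient of
the tensor penalty is a lift of the scalar inequality `ρ(s) ≥ ρ(t) + z (s - t) - μ/2 (s - t)²`
(`tensorPenalty_ge`). The lift rests on von Neumann's trace inequality and on Parseval's identity,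
which ties the Frobenius geometry of real tensors to that of the Fourier slices. -/

/-! ### Singular value decompositions and the trace inequality for matrices. -/

open Matrix in
/-- Rearrangement inequality for doubly stochastic matrices. -/
theorem sum_doublyStochastic_le {d : ℕ} {S : Matrix (Fin d) (Fin d) ℝ}
    (hS : S ∈ doublyStochastic ℝ (Fin d)) {a b : Fin d → ℝ} (ha : Antitone a) (hb : Antitone b) :
    ∑ i, ∑ j, S i j * (a i * b j) ≤ ∑ i, a i * b i := by
  obtain ⟨w, hw0, hw1, rfl⟩ := exists_eq_sum_perm_of_mem_doublyStochastic hS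
  have key : ∀ σ : Equiv.Perm (Fin d), ∑ i, a i * b (σ i) ≤ ∑ i, a i * b i := by
    intro σ
    have hm : Monovary a b := ha.monovary hb
    simpa using hm.sum_smul_comp_perm_le_sum_smul (σ := σ)
  calc ∑ i, ∑ j, (∑ σ, w σ • σ.permMatrix ℝ) i j * (a i * b j)
      = ∑ σ, w σ * ∑ i, a i * b (σ i) := by
        simp only [Matrix.sum_apply, Matrix.smul_apply, Finset.sum_mul, Finset.mul_sum, smul_eq_mul]
        rw [Finset.sum_congr rfl fun i _ => Finset.sum_comm, Finset.sum_comm]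
        refine Finset.sum_congr rfl fun σ _ => Finset.sum_congr rfl fun i _ => ?_
        simp [Equiv.Perm.permMatrix, PEquiv.toMatrix_apply, Equiv.toPEquiv_apply]
    _ ≤ ∑ σ, w σ * ∑ i, a i * b i := by
        exact Finset.sum_le_sum fun σ _ => mul_le_mul_of_nonneg_left (key σ) (hw0 σ)
    _ = ∑ i, a i * b i := by rw [← Finset.sum_mul, hw1, one_mul]

/-- The real Frobenius inner product of complex matrices. -/
def frob {d : ℕ} (A B : Matrix (Fin d) (Fin d) ℂ) : ℝ := (A.conjTranspose * B).trace.re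

/-- A singular value decomposition `A = U diag(a) Vᴴ`. -/
structure IsSVD {d : ℕ} (A U : Matrix (Fin d) (Fin d) ℂ) (a : Fin d → ℝ)
    (V : Matrix (Fin d) (Fin d) ℂ) : Prop where
  left_mem : U ∈ Matrix.unitaryGroup (Fin d) ℂ
  right_mem : V ∈ Matrix.unitaryGroup (Fin d) ℂ
  eq : A = U * Matrix.diagonal (fun i => ((a i : ℝ) : ℂ)) * V.conjTranspose

theorem sum_normSq_row {d : ℕ} {P : Matrix (Fin d) (Fin d) ℂ}
    (hP : P ∈ Matrix.unitaryGroup (Fin d) ℂ) (i : Fin d) : ∑ j, ‖P i j‖ ^ 2 = 1 := by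
  have h := congrFun (congrFun (Matrix.mem_unitaryGroup_iff.1 hP) i) i
  rw [Matrix.mul_apply, Matrix.one_apply_eq] at h
  have h2 : ((∑ j, ‖P i j‖ ^ 2 : ℝ) : ℂ) = 1 := by
    rw [← h]; push_cast
    refine Finset.sum_congr rfl fun j _ => ?_
    rw [Matrix.star_apply, Complex.star_def, Complex.mul_conj']
  exact_mod_cast h2

theorem sum_normSq_col {d : ℕ} {P : Matrix (Fin d) (Fin d) ℂ}
    (hP : P ∈ Matrix.unitaryGroup (Fin d) ℂ) (j : Fin d) : ∑ i, ‖P i j‖ ^ 2 = 1 := by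
  have h := sum_normSq_row (Unitary.star_mem hP) j
  simpa [Matrix.star_apply] using h

/-- **Von Neumann's trace inequality**. -/
theorem frob_le_of_isSVD {d : ℕ} {A B U V U' V' : Matrix (Fin d) (Fin d) ℂ} {a b : Fin d → ℝ}
    (hA : IsSVD A U a V) (hB : IsSVD B U' b V') (ha : Antitone a) (hb : Antitone b)
    (ha0 : ∀ i, 0 ≤ a i) (hb0 : ∀ i, 0 ≤ b i) : frob A B ≤ ∑ i, a i * b i := by
  set P := U.conjTranspose * U' with hPdef
  set Q := V'.conjTranspose * V with hQdef
  have hP : P ∈ Matrix.unitaryGroup (Fin d) ℂ :=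
    mul_mem (Unitary.star_mem hA.left_mem) hB.left_mem
  have hQ : Q ∈ Matrix.unitaryGroup (Fin d) ℂ :=
    mul_mem (Unitary.star_mem hB.right_mem) hA.right_mem
  have htr : frob A B = ∑ i, ∑ j, (a i * b j) * (P i j * Q j i).re := by
    have hd : (Matrix.diagonal (fun i => ((a i : ℝ) : ℂ))).conjTranspose
        = Matrix.diagonal (fun i => ((a i : ℝ) : ℂ)) := by
      rw [Matrix.diagonal_conjTranspose]; congr 1; ext i; simp
    have h1 : (A.conjTranspose * B).trace = ((Matrix.diagonal (fun i => ((a i : ℝ) : ℂ)) * P) *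
        (Matrix.diagonal (fun i => ((b i : ℝ) : ℂ)) * Q)).trace := by
      rw [hA.eq, hB.eq, Matrix.conjTranspose_mul, Matrix.conjTranspose_mul, hd,
        Matrix.conjTranspose_conjTranspose, Matrix.mul_assoc, Matrix.trace_mul_comm, hPdef, hQdef]
      simp only [Matrix.mul_assoc]
    rw [frob, h1, Matrix.trace, Complex.re_sum]
    refine Finset.sum_congr rfl fun i _ => ?_
    rw [Matrix.diag_apply, Matrix.mul_apply, Complex.re_sum]
    refine Finset.sum_congr rfl fun j _ => ?_
    rw [Matrix.diagonal_mul, Matrix.diagonal_mul,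
      show (a i : ℂ) * P i j * ((b j : ℂ) * Q j i) = ((a i * b j : ℝ) : ℂ) * (P i j * Q j i) by
        push_cast; ring, Complex.re_ofReal_mul]
  -- By AM-GM `S` dominates `|P i j * Q j i|`. Squared moduli of unitary entries are doubly
  -- stochastic, hence so is their average, and Birkhoff's theorem reduces the bound to
  -- permutations.
  let S : Matrix (Fin d) (Fin d) ℝ := fun i j => (‖P i j‖ ^ 2 + ‖Q j i‖ ^ 2) / 2
  have hS : S ∈ doublyStochastic ℝ (Fin d) := by
    rw [mem_doublyStochastic_iff_sum]
    refine ⟨fun i j => by positivity, fun i => ?_, fun j => ?_⟩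
    · simp only [S]
      rw [← Finset.sum_div, Finset.sum_add_distrib, sum_normSq_row hP, sum_normSq_col hQ]; norm_num
    · simp only [S]
      rw [← Finset.sum_div, Finset.sum_add_distrib, sum_normSq_col hP, sum_normSq_row hQ]; norm_num
  rw [htr]
  refine le_trans ?_ (sum_doublyStochastic_le hS ha hb)
  refine Finset.sum_le_sum fun i _ => Finset.sum_le_sum fun j _ => ?_
  rw [mul_comm]
  refine mul_le_mul_of_nonneg_right ?_ (mul_nonneg (ha0 i) (hb0 j))
  refine (Complex.re_le_norm _).trans ?_
  rw [norm_mul]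
  simp only [S]
  nlinarith [sq_nonneg (‖P i j‖ - ‖Q j i‖)]

/-- The equality case of the trace inequality: common unitary factors cancel. No order or sign is
imposed on `a` and `b`, so it also covers differences of singular values. -/
theorem frob_of_isSVD {d : ℕ} {A B U V : Matrix (Fin d) (Fin d) ℂ} {a b : Fin d → ℝ}
    (hA : IsSVD A U a V) (hB : IsSVD B U b V) : frob A B = ∑ i, a i * b i := by
  have hd : (Matrix.diagonal (fun i => ((a i : ℝ) : ℂ))).conjTranspose
      = Matrix.diagonal (fun i => ((a i : ℝ) : ℂ)) := by
    rw [Matrix.diagonal_conjTranspose]; congr 1; ext i; simp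
  have hU : U.conjTranspose * U = 1 := Matrix.mem_unitaryGroup_iff'.1 hA.left_mem
  have hV : V.conjTranspose * V = 1 := Matrix.mem_unitaryGroup_iff'.1 hA.right_mem
  have h1 : (A.conjTranspose * B).trace = ∑ i, ((a i * b i : ℝ) : ℂ) := by
    rw [hA.eq, hB.eq, Matrix.conjTranspose_mul, Matrix.conjTranspose_mul, hd,
      Matrix.conjTranspose_conjTranspose, Matrix.mul_assoc, Matrix.trace_mul_comm]
    simp only [Matrix.mul_assoc]
    rw [hV, Matrix.mul_one, ← Matrix.mul_assoc U.conjTranspose, hU, Matrix.one_mul,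
      Matrix.diagonal_mul_diagonal, Matrix.trace_diagonal]
    push_cast; rfl
  rw [frob, h1, ← Complex.ofReal_sum, Complex.ofReal_re]

/-- The right factor is an eigenbasis of `T* T`. The images of its vectors are orthogonal with norms
`σ i`; normalizing the nonzero ones and completing to an orthonormal basis gives the left factor. -/
theorem exists_isSVD {d : ℕ} (A : Matrix (Fin d) (Fin d) ℂ) :
    ∃ U V, IsSVD A U (fun i => (Matrix.toEuclideanLin A).singularValues i) V := by
  set T := Matrix.toEuclideanLin A with hTdef
  have hn : Module.finrank ℂ (EuclideanSpace ℂ (Fin d)) = d := by simp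
  have hT := T.isSymmetric_adjoint_comp_self
  set b := hT.eigenvectorBasis hn
  set σ : Fin d → ℝ := fun i => T.singularValues i with hσ
  have hin : ∀ i j, inner ℂ (T (b i)) (T (b j)) = if i = j then ((σ j : ℂ)) ^ 2 else 0 := by
    intro i j
    have h1 : (LinearMap.adjoint T ∘ₗ T) (b j) = ((σ j ^ 2 : ℝ) : ℂ) • b j := by
      rw [hT.apply_eigenvectorBasis hn j, hσ]
      simp only [T.sq_singularValues_fin hn j]
      rfl
    rw [← LinearMap.adjoint_inner_right, ← LinearMap.comp_apply, h1, inner_smul_right,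
      orthonormal_iff_ite.1 b.orthonormal]
    split_ifs <;> simp
  -- For `σ i = 0` this is the zero vector, harmless because only indices with `σ i ≠ 0` enter the
  -- orthonormal family.
  let v : Fin d → EuclideanSpace ℂ (Fin d) := fun i => ((σ i : ℂ))⁻¹ • T (b i)
  have hv : Orthonormal ℂ (Set.domRestrict {i | σ i ≠ 0} v) := by
    rw [orthonormal_iff_ite]
    rintro ⟨i, hi⟩ ⟨j, hj⟩
    change inner ℂ (v i) (v j) = _
    simp only [v, inner_smul_left, inner_smul_right, hin, Subtype.mk.injEq]
    have hi' : (σ i : ℂ) ≠ 0 := by exact_mod_cast hi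
    split_ifs with h
    · subst h
      simp only [map_inv₀, Complex.conj_ofReal]
      field_simp
    · simp
  obtain ⟨u, hu⟩ := hv.exists_orthonormalBasis_extension_of_card_eq (by simp)
  have hTb : ∀ i, T (b i) = (σ i : ℂ) • u i := by
    intro i
    by_cases hi : σ i = 0
    · have := hin i i
      rw [hi] at this
      simp only [if_true] at this
      rw [hi, Complex.ofReal_zero, zero_smul]
      exact inner_self_eq_zero.1 (by rw [this]; simp)
    · rw [hu i hi]
      have hi' : (σ i : ℂ) ≠ 0 := by exact_mod_cast hi
      simp only [v, smul_smul, mul_inv_cancel₀ hi', one_smul]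
  have hmem : ∀ c : OrthonormalBasis (Fin d) ℂ (EuclideanSpace ℂ (Fin d)),
      (Matrix.of fun k i => c i k) ∈ Matrix.unitaryGroup (Fin d) ℂ := by
    intro c
    rw [Matrix.mem_unitaryGroup_iff']
    ext i j
    have := orthonormal_iff_ite.1 c.orthonormal i j
    rw [Matrix.one_apply, ← this, Matrix.mul_apply, PiLp.inner_apply]
    refine Finset.sum_congr rfl fun k _ => ?_
    simp [Matrix.star_apply, mul_comm]
  refine ⟨Matrix.of fun k i => u i k, Matrix.of fun k i => b i k, hmem u, hmem b, ?_⟩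
  have h1 : A * (Matrix.of fun k i => b i k) = (Matrix.of fun k i => u i k) *
      Matrix.diagonal (fun i => ((σ i : ℝ) : ℂ)) := by
    ext k i
    rw [Matrix.mul_diagonal]
    have := congrFun (congrArg WithLp.ofLp (hTb i)) k
    simp only [hTdef, Matrix.ofLp_toLpLin, Matrix.toLin'_apply] at this
    simp only [Matrix.of_apply]
    rw [mul_comm]
    exact this
  have hV := Matrix.mem_unitaryGroup_iff.1 (hmem b)
  rw [← h1, Matrix.mul_assoc]
  exact (by rw [← Matrix.star_eq_conjTranspose, hV, Matrix.mul_one])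

theorem frob_add_right {d : ℕ} (A B C : Matrix (Fin d) (Fin d) ℂ) :
    frob A (B + C) = frob A B + frob A C := by
  simp [frob, Matrix.mul_add]

theorem frob_smul_right {d : ℕ} (r : ℝ) (A B : Matrix (Fin d) (Fin d) ℂ) :
    frob A ((r : ℂ) • B) = r * frob A B := by
  simp [frob]

theorem frob_eq_sum {d : ℕ} (A B : Matrix (Fin d) (Fin d) ℂ) :
    frob A B = ∑ a, ∑ b, (star (A a b) * B a b).re := by
  simp only [frob, Matrix.trace, Matrix.diag_apply, Matrix.mul_apply, Matrix.conjTranspose_apply,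
    Complex.re_sum]
  exact Finset.sum_comm

theorem frob_comm {d : ℕ} (A B : Matrix (Fin d) (Fin d) ℂ) : frob A B = frob B A := by
  rw [frob_eq_sum, frob_eq_sum]
  refine Finset.sum_congr rfl fun a _ => Finset.sum_congr rfl fun b _ => ?_
  simp [mul_comm]

theorem frob_self_nonneg {d : ℕ} (A : Matrix (Fin d) (Fin d) ℂ) : 0 ≤ frob A A := by
  rw [frob_eq_sum]
  refine Finset.sum_nonneg fun a _ => Finset.sum_nonneg fun b _ => ?_
  simp only [Complex.star_def, Complex.mul_re, Complex.conj_re, Complex.conj_im]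
  nlinarith [mul_self_nonneg (A a b).re, mul_self_nonneg (A a b).im]

theorem frob_sub_self {d : ℕ} (A B : Matrix (Fin d) (Fin d) ℂ) :
    frob (A - B) (A - B) = frob A A - 2 * frob A B + frob B B := by
  have h : ∀ C D E : Matrix (Fin d) (Fin d) ℂ, frob C (D - E) = frob C D - frob C E := by
    intro C D E; simp [frob, Matrix.mul_sub]
  rw [h, frob_comm (A - B) A, frob_comm (A - B) B, h, h, frob_comm B A]
  ring

/-- **Mirsky's inequality** for the Frobenius norm. -/
theorem sum_sub_sq_le_frob {d : ℕ} {A B U V U' V' : Matrix (Fin d) (Fin d) ℂ} {a b : Fin d → ℝ}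
    (hA : IsSVD A U a V) (hB : IsSVD B U' b V') (ha : Antitone a) (hb : Antitone b)
    (ha0 : ∀ i, 0 ≤ a i) (hb0 : ∀ i, 0 ≤ b i) :
    ∑ i, (a i - b i) ^ 2 ≤ frob (A - B) (A - B) := by
  have h1 := frob_le_of_isSVD hA hB ha hb ha0 hb0
  have h2 := frob_of_isSVD hA hA
  have h3 := frob_of_isSVD hB hB
  have h4 : ∑ i, (a i - b i) ^ 2 = ∑ i, a i * a i - 2 * ∑ i, a i * b i + ∑ i, b i * b i := by
    rw [Finset.mul_sum, ← Finset.sum_sub_distrib, ← Finset.sum_add_distrib]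
    exact Finset.sum_congr rfl fun i _ => by ring
  rw [frob_sub_self, h4, h2, h3]
  linarith

/-- Sorted singular values do not depend on the decomposition. -/
theorem IsSVD.unique {d : ℕ} {A U V U' V' : Matrix (Fin d) (Fin d) ℂ} {a b : Fin d → ℝ}
    (hA : IsSVD A U a V) (hB : IsSVD A U' b V') (ha : Antitone a) (hb : Antitone b)
    (ha0 : ∀ i, 0 ≤ a i) (hb0 : ∀ i, 0 ≤ b i) : a = b := by
  have h := sum_sub_sq_le_frob hA hB ha hb ha0 hb0
  have h0 : frob (A - A) (A - A) = 0 := by simp [frob]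
  rw [h0] at h
  have h1 := (Finset.sum_eq_zero_iff_of_nonneg (fun i _ => sq_nonneg (a i - b i))).1
    (le_antisymm h (Finset.sum_nonneg fun i _ => sq_nonneg _))
  ext i
  exact sub_eq_zero.1 (pow_eq_zero_iff two_ne_zero |>.1 (h1 i (Finset.mem_univ i)))

/-! ### Parseval's identity and singular values in the Fourier domain. -/

section Fourier

variable {d d₃ : ℕ} [NeZero d₃]

theorem fourierSlice_apply (T : Tensor d d₃) (j : ZMod d₃) (a b : Fin d) :
    fourierSlice T j a b = ∑ k, ZMod.stdAddChar (-(k * j)) * ((T (a, b, k) : ℝ) : ℂ) := by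
  simp [fourierSlice, ZMod.dft_apply, Matrix.sum_apply]

theorem fourierSlice_add (T S : Tensor d d₃) (j : ZMod d₃) :
    fourierSlice (T + S) j = fourierSlice T j + fourierSlice S j := by
  ext a b
  simp [fourierSlice_apply, mul_add, Finset.sum_add_distrib]

theorem fourierSlice_smul (r : ℝ) (T : Tensor d d₃) (j : ZMod d₃) :
    fourierSlice (r • T) j = (r : ℂ) • fourierSlice T j := by
  ext a b
  simp only [fourierSlice_apply, PiLp.smul_apply, smul_eq_mul, Complex.ofReal_mul,
    Matrix.smul_apply, Finset.mul_sum]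
  exact Finset.sum_congr rfl fun k _ => by ring

theorem fourierSlice_sub (T S : Tensor d d₃) (j : ZMod d₃) :
    fourierSlice (T - S) j = fourierSlice T j - fourierSlice S j := by
  ext a b
  simp [fourierSlice_apply, mul_sub, Finset.sum_sub_distrib]

/-- The scaled real inner product of families of frontal slices. -/
def sliceInner (A B : ZMod d₃ → Matrix (Fin d) (Fin d) ℂ) : ℝ :=
  (1 / (d₃ : ℝ)) * ∑ j, frob (A j) (B j)

/-- Orthogonality of the additive characters: after expanding both sums, only the diagonal `k = l`
survives the summation over `j`. -/
theorem sum_star_dft_mul_dft (f g : ZMod d₃ → ℝ) :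
    ∑ j : ZMod d₃, star (∑ k, ZMod.stdAddChar (-(k * j)) * ((f k : ℝ) : ℂ)) *
      (∑ k, ZMod.stdAddChar (-(k * j)) * ((g k : ℝ) : ℂ)) = (d₃ : ℂ) * ∑ k, (f k : ℂ) * g k := by
  have horth : ∀ t : ZMod d₃, ∑ j, (ZMod.stdAddChar (t * j) : ℂ) = if t = 0 then (d₃ : ℂ) else 0 := by
    intro t
    split_ifs with h
    · simp [h, ZMod.card]
    · exact AddChar.sum_eq_zero_of_ne_one (ZMod.isPrimitive_stdAddChar d₃ h)
  have hterm : ∀ j : ZMod d₃, star (∑ k, ZMod.stdAddChar (-(k * j)) * ((f k : ℝ) : ℂ)) *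
      (∑ k, ZMod.stdAddChar (-(k * j)) * ((g k : ℝ) : ℂ)) =
      ∑ k, ∑ l, ((f k : ℂ) * g l) * ZMod.stdAddChar ((k - l) * j) := by
    intro j
    rw [star_sum, Finset.sum_mul_sum]
    refine Finset.sum_congr rfl fun k _ => Finset.sum_congr rfl fun l _ => ?_
    rw [star_mul', Complex.star_def, ← AddChar.map_neg_eq_conj, neg_neg,
      Complex.conj_ofReal, sub_mul, sub_eq_add_neg, AddChar.map_add_eq_mul]
    ring
  rw [Finset.sum_congr rfl fun j _ => hterm j, Finset.sum_comm, Finset.mul_sum]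
  refine Finset.sum_congr rfl fun k _ => ?_
  rw [Finset.sum_comm]
  simp only [← Finset.mul_sum, horth, sub_eq_zero, mul_ite, mul_zero, Finset.sum_ite_eq,
    Finset.mem_univ, if_true]
  ring

/-- Parseval's identity. -/
theorem sliceInner_fourierSlice (T S : Tensor d d₃) :
    sliceInner (fourierSlice T) (fourierSlice S) = inner ℝ T S := by
  have hd : (d₃ : ℝ) ≠ 0 := Nat.cast_ne_zero.2 (NeZero.ne d₃)
  have h : ∑ j, frob (fourierSlice T j) (fourierSlice S j) = d₃ * inner ℝ T S := by
    simp only [frob_eq_sum, fourierSlice_apply]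
    rw [Finset.sum_comm, PiLp.inner_apply, Fintype.sum_prod_type, Finset.mul_sum]
    refine Finset.sum_congr rfl fun a _ => ?_
    rw [Finset.sum_comm, Fintype.sum_prod_type, Finset.mul_sum]
    refine Finset.sum_congr rfl fun b _ => ?_
    rw [← Complex.re_sum, sum_star_dft_mul_dft (fun k => T (a, b, k)) (fun k => S (a, b, k))]
    rw [← Complex.ofReal_natCast, Complex.re_ofReal_mul, Complex.re_sum]
    congr 1
    refine Finset.sum_congr rfl fun k _ => ?_
    rw [← Complex.ofReal_mul, Complex.ofReal_re]
    simp [mul_comm]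
  rw [sliceInner, h]
  field_simp

theorem sliceInner_fourierSlice_self (T : Tensor d d₃) :
    sliceInner (fourierSlice T) (fourierSlice T) = ‖T‖ ^ 2 := by
  rw [sliceInner_fourierSlice, real_inner_self_eq_norm_sq]

theorem sliceInner_self_nonneg (A : ZMod d₃ → Matrix (Fin d) (Fin d) ℂ) : 0 ≤ sliceInner A A :=
  mul_nonneg (by positivity) (Finset.sum_nonneg fun j _ => frob_self_nonneg _)

/-- A family of frontal slices acts on real tensors like a real tensor of no larger norm. -/
theorem exists_tensor_inner_eq (A : ZMod d₃ → Matrix (Fin d) (Fin d) ℂ) :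
    ∃ Z : Tensor d d₃, (∀ Y, inner ℝ Z Y = sliceInner A (fourierSlice Y)) ∧
      ‖Z‖ ^ 2 ≤ sliceInner A A := by
  -- `A` need not be the transform of a real tensor, so `Z` is obtained as the Riesz representative
  -- of the functional that `A` induces on real tensors.
  let φ : Tensor d d₃ →ₗ[ℝ] ℝ :=
    { toFun := fun Y => sliceInner A (fourierSlice Y)
      map_add' := fun Y Y' => by
        simp only [sliceInner, fourierSlice_add, frob_add_right, Finset.sum_add_distrib, mul_add]
      map_smul' := fun r Y => by
        simp only [sliceInner, fourierSlice_smul, frob_smul_right, ← Finset.mul_sum, smul_eq_mul,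
          RingHom.id_apply]
        ring }
  refine ⟨(InnerProductSpace.toDual ℝ _).symm (LinearMap.toContinuousLinearMap φ), ?_, ?_⟩
  · intro Y
    rw [InnerProductSpace.toDual_symm_apply]
    rfl
  · set Z := (InnerProductSpace.toDual ℝ _).symm (LinearMap.toContinuousLinearMap φ) with hZ
    have h1 : inner ℝ Z Z = sliceInner A (fourierSlice Z) := by
      rw [hZ, InnerProductSpace.toDual_symm_apply]
      rfl
    rw [real_inner_self_eq_norm_sq] at h1
    -- `Z` acts as the orthogonal projection of `A`: the cross term in the expanded square is `‖Z‖ ^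
    -- 2`, which yields the norm bound.
    have h2 : 0 ≤ sliceInner (A - fourierSlice Z) (A - fourierSlice Z) := sliceInner_self_nonneg _
    have h3 : sliceInner (A - fourierSlice Z) (A - fourierSlice Z) =
        sliceInner A A - 2 * sliceInner A (fourierSlice Z) + ‖Z‖ ^ 2 := by
      rw [← sliceInner_fourierSlice_self]
      simp only [sliceInner, Pi.sub_apply, frob_sub_self, Finset.sum_add_distrib,
        Finset.sum_sub_distrib, ← Finset.mul_sum]
      ring
    linarith

theorem sv_nonneg (T : Tensor d d₃) (i : Fin d) (j : ZMod d₃) : 0 ≤ sv T i j :=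
  LinearMap.singularValues_nonneg _ _

theorem sv_antitone (T : Tensor d d₃) (j : ZMod d₃) : Antitone fun i => sv T i j :=
  fun _ _ h => LinearMap.singularValues_antitone _ h

theorem exists_isSVD_sv (T : Tensor d d₃) (j : ZMod d₃) :
    ∃ U V, IsSVD (fourierSlice T j) U (fun i => sv T i j) V :=
  exists_isSVD _

/-- The sum over all slices and indices, scaled as in the tensor penalty. -/
def avgSum (a : Fin d → ZMod d₃ → ℝ) : ℝ := (1 / (d₃ : ℝ)) * ∑ i, ∑ j, a i j

theorem avgSum_mono {a b : Fin d → ZMod d₃ → ℝ} (h : ∀ i j, a i j ≤ b i j) :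
    avgSum a ≤ avgSum b :=
  mul_le_mul_of_nonneg_left
    (Finset.sum_le_sum fun i _ => Finset.sum_le_sum fun j _ => h i j) (by positivity)

theorem avgSum_add (a b : Fin d → ZMod d₃ → ℝ) :
    avgSum (fun i j => a i j + b i j) = avgSum a + avgSum b := by
  simp only [avgSum, Finset.sum_add_distrib]; ring

theorem avgSum_const_mul (r : ℝ) (a : Fin d → ZMod d₃ → ℝ) :
    avgSum (fun i j => r * a i j) = r * avgSum a := by
  simp only [avgSum, ← Finset.mul_sum]; ring

theorem tensorPenalty_eq_avgSum (ρ : ℝ → ℝ) (T : Tensor d d₃) :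
    tensorPenalty ρ T = avgSum fun i j => ρ (sv T i j) := rfl

theorem sliceInner_le_of_isSVD {A B U V U' V' : ZMod d₃ → Matrix (Fin d) (Fin d) ℂ}
    {a b : Fin d → ZMod d₃ → ℝ} (hA : ∀ j, IsSVD (A j) (U j) (fun i => a i j) (V j))
    (hB : ∀ j, IsSVD (B j) (U' j) (fun i => b i j) (V' j))
    (ha : ∀ j, Antitone fun i => a i j) (hb : ∀ j, Antitone fun i => b i j)
    (ha0 : ∀ i j, 0 ≤ a i j) (hb0 : ∀ i j, 0 ≤ b i j) :
    sliceInner A B ≤ avgSum fun i j => a i j * b i j := by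
  rw [sliceInner, avgSum, Finset.sum_comm]
  exact mul_le_mul_of_nonneg_left (Finset.sum_le_sum fun j _ =>
    frob_le_of_isSVD (hA j) (hB j) (ha j) (hb j) (ha0 · j) (hb0 · j)) (by positivity)

theorem sliceInner_of_isSVD {A B U V : ZMod d₃ → Matrix (Fin d) (Fin d) ℂ}
    {a b : Fin d → ZMod d₃ → ℝ} (hA : ∀ j, IsSVD (A j) (U j) (fun i => a i j) (V j))
    (hB : ∀ j, IsSVD (B j) (U j) (fun i => b i j) (V j)) :
    sliceInner A B = avgSum fun i j => a i j * b i j := by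
  rw [sliceInner, avgSum, Finset.sum_comm]
  congr 1
  exact Finset.sum_congr rfl fun j _ => frob_of_isSVD (hA j) (hB j)

/-- Mirsky's inequality on each slice, summed with Parseval's identity. -/
theorem avgSum_sv_sub_sq_le (T S : Tensor d d₃) :
    avgSum (fun i j => (sv T i j - sv S i j) ^ 2) ≤ ‖T - S‖ ^ 2 := by
  choose U V hUV using exists_isSVD_sv T
  choose U' V' hUV' using exists_isSVD_sv S
  rw [← sliceInner_fourierSlice_self, sliceInner, avgSum, Finset.sum_comm]
  refine mul_le_mul_of_nonneg_left (Finset.sum_le_sum fun j _ => ?_) (by positivity)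
  rw [fourierSlice_sub]
  exact sum_sub_sq_le_frob (hUV j) (hUV' j) (sv_antitone T j) (sv_antitone S j)
    (sv_nonneg T · j) (sv_nonneg S · j)

theorem avgSum_sv_sq (T : Tensor d d₃) : avgSum (fun i j => sv T i j * sv T i j) = ‖T‖ ^ 2 := by
  choose U V hUV using exists_isSVD_sv T
  rw [← sliceInner_fourierSlice_self, sliceInner_of_isSVD hUV hUV]

theorem continuous_sv (i : Fin d) (j : ZMod d₃) : Continuous fun T : Tensor d d₃ => sv T i j := by
  have hd : (0 : ℝ) < d₃ := Nat.cast_pos.2 (NeZero.pos d₃)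
  have hlip : ∀ T S : Tensor d d₃, |sv T i j - sv S i j| ≤ √d₃ * ‖T - S‖ := by
    intro T S
    have h1 := avgSum_sv_sub_sq_le T S
    have h2 : (sv T i j - sv S i j) ^ 2 ≤ ∑ i, ∑ j, (sv T i j - sv S i j) ^ 2 := by
      refine le_trans ?_ (Finset.single_le_sum (f := fun i => ∑ j, (sv T i j - sv S i j) ^ 2)
        (fun i _ => Finset.sum_nonneg fun j _ => sq_nonneg _) (Finset.mem_univ i))
      exact Finset.single_le_sum (f := fun j => (sv T i j - sv S i j) ^ 2)
        (fun j _ => sq_nonneg _) (Finset.mem_univ j)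
    rw [avgSum, one_div, inv_mul_le_iff₀ hd] at h1
    refine abs_le_of_sq_le_sq ?_ (by positivity)
    rw [mul_pow, Real.sq_sqrt hd.le]
    exact h2.trans h1
  refine (LipschitzWith.of_dist_le_mul (K := ⟨√d₃, Real.sqrt_nonneg _⟩) fun T S => ?_).continuous
  rw [Real.dist_eq, dist_eq_norm]
  exact hlip T S

/-- Singular value thresholding with nondecreasing thresholds acts on the singular values. -/
theorem IsWtSVT.exists_isSVD {G X : Tensor d d₃} {τ : Fin d → ZMod d₃ → ℝ} (h : IsWtSVT G τ X)
    (hτ : ∀ j, Monotone fun i => τ i j) :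
    (∃ U V : ZMod d₃ → Matrix (Fin d) (Fin d) ℂ,
      (∀ j, IsSVD (fourierSlice G j) (U j) (fun i => sv G i j) (V j)) ∧
      ∀ j, IsSVD (fourierSlice X j) (U j) (fun i => sv X i j) (V j)) ∧
    ∀ i j, sv X i j = max (sv G i j - τ i j) 0 := by
  choose U hU V hV hG hX using h
  have hsv : ∀ i j, sv X i j = max (sv G i j - τ i j) 0 := by
    intro i j
    obtain ⟨U', V', h'⟩ := exists_isSVD_sv X j
    refine congrFun (h'.unique ⟨hU j, hV j, hX j⟩ (sv_antitone X j) ?_ (sv_nonneg X · j)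
      fun i => le_max_right _ _) i
    -- Nondecreasing thresholds keep the thresholded values sorted, so uniqueness of sorted singular
    -- values identifies them with `sv X`.
    exact fun i₁ i₂ h12 => max_le_max_right 0 (sub_le_sub (sv_antitone G j h12) (hτ j h12))
  refine ⟨⟨U, V, fun j => ⟨hU j, hV j, hG j⟩, fun j => ⟨hU j, hV j, ?_⟩⟩, hsv⟩
  simp only [hsv]
  exact hX j

end Fourier

/-! ### One-sided calculus of the scalar penalty. -/

section Penalty

/-- The derivative of a penalty on `(0, ∞)`, extended to `0` by the value `C`. -/
def penaltyDeriv (ρ : ℝ → ℝ) (C x : ℝ) : ℝ := if 0 < x then deriv ρ x else C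

theorem penaltyDeriv_of_pos (ρ : ℝ → ℝ) (C : ℝ) {x : ℝ} (hx : 0 < x) :
    penaltyDeriv ρ C x = deriv ρ x := if_pos hx

theorem penaltyDeriv_zero (ρ : ℝ → ℝ) (C : ℝ) : penaltyDeriv ρ C 0 = C := if_neg (lt_irrefl _)

variable {ρ : ℝ → ℝ} {C μ : ℝ}

theorem IsPenalty.deriv_anti (hρ : IsPenalty ρ) {x y : ℝ} (hx : 0 < x) (hxy : x < y) :
    deriv ρ y ≤ deriv ρ x :=
  (hρ.concaveOn.deriv_le_slope hx.le (hx.trans hxy).le hxy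
    (hρ.differentiableAt y (hx.trans hxy).ne')).trans
  (hρ.concaveOn.slope_le_deriv hx.le (hx.trans hxy).le hxy (hρ.differentiableAt x hx.ne'))

theorem IsPenalty.deriv_nonneg (hρ : IsPenalty ρ) {x : ℝ} (hx : 0 < x) : 0 ≤ deriv ρ x := by
  have h := hρ.concaveOn.slope_le_deriv (x := x) (y := x + 1) hx.le (Set.mem_Ici.2 (by linarith))
    (by linarith) (hρ.differentiableAt x hx.ne')
  refine le_trans ?_ h
  rw [slope_def_field]
  have := hρ.monotoneOn (Set.mem_Ici.2 hx.le) (Set.mem_Ici.2 (by linarith : (0 : ℝ) ≤ x + 1))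
    (by linarith)
  exact div_nonneg (by linarith) (by linarith)

theorem IsPenalty.hasDerivAt_add_sq (hρ : IsPenalty ρ) {x : ℝ} (hx : 0 < x) :
    HasDerivAt (fun x => ρ x + μ / 2 * x ^ 2) (deriv ρ x + μ * x) x := by
  have h := (hρ.differentiableAt x hx.ne').hasDerivAt.add
    (((hasDerivAt_id x).pow 2).const_mul (μ / 2))
  convert! h using 1
  simp; ring

/-- Convexity of `ρ + μ/2 x²` makes `ρ' + μ x` nondecreasing; with concavity this yields the
Lipschitz bound on `ρ'`. -/
theorem IsPenalty.deriv_sub_le (hρ : IsPenalty ρ)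
    (hμ : ConvexOn ℝ Set.univ (fun x => ρ x + μ / 2 * x ^ 2)) {x y : ℝ} (hx : 0 < x)
    (hxy : x < y) : deriv ρ x - deriv ρ y ≤ μ * (y - x) := by
  have hdx := hρ.hasDerivAt_add_sq (μ := μ) hx
  have hdy := hρ.hasDerivAt_add_sq (μ := μ) (hx.trans hxy)
  have h1 := hμ.deriv_le_slope (Set.mem_univ x) (Set.mem_univ y) hxy hdx.differentiableAt
  have h2 := hμ.slope_le_deriv (Set.mem_univ x) (Set.mem_univ y) hxy hdy.differentiableAt
  rw [hdx.deriv] at h1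
  rw [hdy.deriv] at h2
  linarith

theorem IsPenalty.lower_bound_of_pos (hρ : IsPenalty ρ)
    (hμ : ConvexOn ℝ Set.univ (fun x => ρ x + μ / 2 * x ^ 2)) {t : ℝ} (ht : 0 < t) (s : ℝ) :
    ρ t + deriv ρ t * (s - t) - μ / 2 * (s - t) ^ 2 ≤ ρ s := by
  have hd := hρ.hasDerivAt_add_sq (μ := μ) ht
  rcases lt_trichotomy s t with h | rfl | h
  · have h1 := hμ.slope_le_deriv (Set.mem_univ s) (Set.mem_univ t) h hd.differentiableAt
    rw [hd.deriv, slope_def_field, div_le_iff₀ (by linarith)] at h1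
    nlinarith
  · simp
  · have h1 := hμ.deriv_le_slope (Set.mem_univ t) (Set.mem_univ s) h hd.differentiableAt
    rw [hd.deriv, slope_def_field, le_div_iff₀ (by linarith)] at h1
    nlinarith

theorem IsPenalty.penaltyDeriv_anti (hρ : IsPenalty ρ)
    (hC : Tendsto (deriv ρ) (𝓝[>] 0) (𝓝 C)) {x y : ℝ} (hx : 0 ≤ x) (hxy : x ≤ y) :
    penaltyDeriv ρ C y ≤ penaltyDeriv ρ C x := by
  rcases hxy.eq_or_lt with rfl | hxy
  · rfl
  rw [penaltyDeriv_of_pos ρ C (hx.trans_lt hxy)]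
  rcases hx.eq_or_lt with rfl | hx
  · rw [penaltyDeriv_zero]
    refine ge_of_tendsto hC ?_
    filter_upwards [Ioo_mem_nhdsGT hxy] with t ht
    exact hρ.deriv_anti ht.1 ht.2
  · rw [penaltyDeriv_of_pos ρ C hx]
    exact hρ.deriv_anti hx hxy

theorem IsPenalty.penaltyDeriv_nonneg (hρ : IsPenalty ρ)
    (hC : Tendsto (deriv ρ) (𝓝[>] 0) (𝓝 C)) (x : ℝ) : 0 ≤ penaltyDeriv ρ C x := by
  rw [penaltyDeriv]
  split_ifs with hx
  · exact hρ.deriv_nonneg hx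
  · refine ge_of_tendsto hC ?_
    filter_upwards [self_mem_nhdsWithin] with t ht
    exact hρ.deriv_nonneg ht

theorem IsPenalty.penaltyDeriv_sub_le (hρ : IsPenalty ρ)
    (hC : Tendsto (deriv ρ) (𝓝[>] 0) (𝓝 C))
    (hμ0 : 0 < μ) (hμ : ConvexOn ℝ Set.univ (fun x => ρ x + μ / 2 * x ^ 2)) {x y : ℝ} (hx : 0 ≤ x)
    (hxy : x ≤ y) : penaltyDeriv ρ C x - penaltyDeriv ρ C y ≤ μ * (y - x) := by
  rcases hxy.eq_or_lt with rfl | hxy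
  · simp
  rw [penaltyDeriv_of_pos ρ C (hx.trans_lt hxy)]
  rcases hx.eq_or_lt with rfl | hx
  · rw [penaltyDeriv_zero, sub_le_iff_le_add]
    refine le_of_tendsto hC ?_
    filter_upwards [Ioo_mem_nhdsGT hxy] with t ht
    have := hρ.deriv_sub_le hμ ht.1 ht.2
    nlinarith [ht.1]
  · rw [penaltyDeriv_of_pos ρ C hx]
    exact hρ.deriv_sub_le hμ hx hxy

theorem IsPenalty.abs_penaltyDeriv_sub_le (hρ : IsPenalty ρ)
    (hC : Tendsto (deriv ρ) (𝓝[>] 0) (𝓝 C))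
    (hμ0 : 0 < μ) (hμ : ConvexOn ℝ Set.univ (fun x => ρ x + μ / 2 * x ^ 2)) {x y : ℝ} (hx : 0 ≤ x)
    (hy : 0 ≤ y) : |penaltyDeriv ρ C x - penaltyDeriv ρ C y| ≤ μ * |x - y| := by
  wlog hxy : x ≤ y generalizing x y
  · rw [abs_sub_comm, abs_sub_comm x]
    exact this hy hx (le_of_not_ge hxy)
  rw [abs_of_nonneg (sub_nonneg.2 (hρ.penaltyDeriv_anti hC hx hxy)), abs_sub_comm,
    abs_of_nonneg (sub_nonneg.2 hxy)]
  exact hρ.penaltyDeriv_sub_le hC hμ0 hμ hx hxy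

/-- The tangent line to the convex function `ρ + μ/2 x²`, rewritten around `t`; at `t = 0` the
inequality is the limit of those for `t → 0⁺`. -/
theorem IsPenalty.lower_bound (hρ : IsPenalty ρ)
    (hC : Tendsto (deriv ρ) (𝓝[>] 0) (𝓝 C))
    (hμ : ConvexOn ℝ Set.univ (fun x => ρ x + μ / 2 * x ^ 2)) {t : ℝ} (ht : 0 ≤ t)
    (s : ℝ) :
    ρ t + penaltyDeriv ρ C t * (s - t) - μ / 2 * (s - t) ^ 2 ≤ ρ s := by
  rcases ht.eq_or_lt with rfl | ht
  · rw [penaltyDeriv_zero]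
    have hc : Tendsto ρ (𝓝[>] 0) (𝓝 (ρ 0)) :=
      (hρ.continuousOn 0 (Set.mem_Ici.2 le_rfl)).mono Set.Ioi_subset_Ici_self
    have hid : Tendsto (fun t : ℝ => s - t) (𝓝[>] 0) (𝓝 (s - 0)) :=
      tendsto_const_nhds.sub (tendsto_id.mono_left nhdsWithin_le_nhds)
    refine le_of_tendsto ((hc.add (hC.mul hid)).sub ((hid.pow 2).const_mul (μ / 2))) ?_
    filter_upwards [self_mem_nhdsWithin] with t ht
    exact hρ.lower_bound_of_pos hμ ht s
  · rw [penaltyDeriv_of_pos ρ C ht]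
    exact hρ.lower_bound_of_pos hμ ht s

theorem IsPenalty.le_mul (hρ : IsPenalty ρ) (hC : Tendsto (deriv ρ) (𝓝[>] 0) (𝓝 C)) {s : ℝ}
    (hs : 0 ≤ s) : ρ s ≤ C * s := by
  rcases hs.eq_or_lt with rfl | hs
  · simp [hρ.map_zero]
  have hc : Tendsto ρ (𝓝[>] 0) (𝓝 (ρ 0)) :=
    (hρ.continuousOn 0 (Set.mem_Ici.2 le_rfl)).mono Set.Ioi_subset_Ici_self
  have hid : Tendsto (fun t : ℝ => s - t) (𝓝[>] 0) (𝓝 (s - 0)) :=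
    tendsto_const_nhds.sub (tendsto_id.mono_left nhdsWithin_le_nhds)
  have h := hc.add (hC.mul hid)
  rw [hρ.map_zero, sub_zero, zero_add] at h
  refine ge_of_tendsto h ?_
  filter_upwards [Ioo_mem_nhdsGT hs] with t ht
  have h1 := hρ.concaveOn.slope_le_deriv (Set.mem_Ici.2 ht.1.le) (Set.mem_Ici.2 hs.le) ht.2
    (hρ.differentiableAt t ht.1.ne')
  rw [slope_def_field, div_le_iff₀ (by linarith [ht.2])] at h1
  linarith

/-- Moving from `x` by a small positive multiple of `v - f'(x)` would contradict the subgradient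
inequality if this difference were nonzero. -/
theorem frechetSubdiff_eq_of_deriv {f : ℝ → ℝ} {x v : ℝ} (hf : DifferentiableAt ℝ f x)
    (hv : v ∈ frechetSubdiff f x) : v = deriv f x := by
  have hd := hasDerivAt_iff_isLittleO.1 hf.hasDerivAt
  have key : ∀ ε > 0, ∀ᶠ y in 𝓝 x, (v - deriv f x) * (y - x) ≤ ε * |y - x| := by
    intro ε hε
    filter_upwards [hv (ε / 2) (by linarith), hd.def (half_pos hε)] with y h1 h2
    have h3 := (abs_le.1 (by simpa using h2 : |f y - f x - (y - x) * deriv f x| ≤ ε / 2 * |y - x|)).2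
    have h4 : inner ℝ v (y - x) = v * (y - x) := by simp [mul_comm]
    rw [h4, Real.norm_eq_abs] at h1
    linarith
  by_contra hne
  have hε : 0 < |v - deriv f x| / 2 := by
    have := abs_pos.2 (sub_ne_zero.2 hne)
    linarith
  have hmap : Tendsto (fun t : ℝ => x + t * (v - deriv f x)) (𝓝[>] 0) (𝓝 x) := by
    have : Continuous fun t : ℝ => x + t * (v - deriv f x) := by fun_prop
    have h := this.tendsto 0
    simp only [zero_mul, add_zero] at h
    exact h.mono_left nhdsWithin_le_nhds
  obtain ⟨t, h1, ht⟩ := ((hmap.eventually (key _ hε)).and self_mem_nhdsWithin).exists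
  have ht : 0 < t := ht
  rw [add_sub_cancel_left, abs_mul, abs_of_pos ht] at h1
  have h2 : 0 < t * (|v - deriv f x| * |v - deriv f x|) := by positivity
  have h3 : |v - deriv f x| * |v - deriv f x| = (v - deriv f x) * (v - deriv f x) := abs_mul_abs_self _
  nlinarith

theorem IsPenalty.frechetSubdiff_le (hρ : IsPenalty ρ)
    (hC : Tendsto (deriv ρ) (𝓝[>] 0) (𝓝 C)) {x v : ℝ} (hv : v ∈ frechetSubdiff ρ x) : v ≤ C := by
  have hC0 : 0 ≤ C := by simpa [penaltyDeriv_zero] using hρ.penaltyDeriv_nonneg hC 0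
  rcases lt_trichotomy x 0 with h | rfl | h
  · rw [frechetSubdiff_eq_of_deriv (hρ.differentiableAt x h.ne) hv]
    have h1 : deriv ρ x = - deriv ρ (-x) := by
      have h2 : (fun y => ρ (-y)) = ρ := funext hρ.symm
      have := deriv_comp_neg (f := ρ) (x := x)
      rw [h2] at this
      exact this
    have := hρ.deriv_nonneg (x := -x) (by linarith)
    linarith
  · refine le_of_forall_pos_le_add fun ε hε => ?_
    obtain ⟨y, h1, hy⟩ := (((hv ε hε).filter_mono (nhdsWithin_le_nhds (s := Set.Ioi 0))).and
      self_mem_nhdsWithin).exists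
    have hy : 0 < y := hy
    have h2 := hρ.le_mul hC hy.le
    have h4 : inner ℝ v (y - 0) = v * y := by simp [mul_comm]
    rw [h4, hρ.map_zero, sub_zero, Real.norm_eq_abs, abs_of_pos hy] at h1
    by_contra hlt
    push Not at hlt
    nlinarith
  · rw [frechetSubdiff_eq_of_deriv (hρ.differentiableAt x h.ne') hv]
    have h1 := hρ.penaltyDeriv_anti hC le_rfl h.le
    rwa [penaltyDeriv_of_pos ρ C h, penaltyDeriv_zero] at h1

/-- The admissible weights are determined by the penalty. -/
theorem IsPenalty.weight_eq (hρ : IsPenalty ρ)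
    (hC : Tendsto (deriv ρ) (𝓝[>] 0) (𝓝 C)) {x w : ℝ} (hx : 0 ≤ x) (hw : w ∈ subdiff ρ x)
    (hmaj : ∀ s, 0 ≤ s → ρ s ≤ ρ x + w * (s - x)) : w = penaltyDeriv ρ C x := by
  rcases hx.eq_or_lt with rfl | hx
  · rw [penaltyDeriv_zero]
    -- The two conditions on a weight at zero are complementary: membership in the subdifferential
    -- gives `w ≤ C`, while the majorization gives `w ≥ ρ(t)/t ≥ ρ'(t)`, which tends to `C`.
    refine le_antisymm ?_ ?_
    · obtain ⟨u, v, -, -, hv, hlim⟩ := hw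
      exact le_of_tendsto' hlim fun n => hρ.frechetSubdiff_le hC (hv n)
    · refine le_of_tendsto hC ?_
      filter_upwards [self_mem_nhdsWithin] with t ht
      have ht : 0 < t := ht
      have h1 := hρ.concaveOn.deriv_le_slope (Set.mem_Ici.2 le_rfl) (Set.mem_Ici.2 ht.le) ht
        (hρ.differentiableAt t ht.ne')
      rw [slope_def_field, le_div_iff₀ (by linarith)] at h1
      have h2 := hmaj t ht.le
      nlinarith
  · rw [penaltyDeriv_of_pos ρ C hx]
    have hd := (((hasDerivAt_id x).sub_const x).const_mul w).const_add (ρ x) |>.sub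
      (hρ.differentiableAt x hx.ne').hasDerivAt
    have hmin : IsLocalMin ((fun s => ρ x + w * (id s - x)) - ρ) x := by
      filter_upwards [lt_mem_nhds hx] with s hs
      have := hmaj s hs.le
      simp only [Pi.sub_apply, id]
      linarith
    have := hmin.hasDerivAt_eq_zero hd
    linarith

end Penalty

/-! ### Convergence of descent sequences under the Kurdyka-Łojasiewicz property. -/

section Descent

variable {E : Type*} [NormedAddCommGroup E] [InnerProductSpace ℝ E]

theorem frechetSubdiff_subset_subdiff (f : E → ℝ) (x : E) : frechetSubdiff f x ⊆ subdiff f x :=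
  fun v hv => ⟨fun _ => x, fun _ => v, tendsto_const_nhds, tendsto_const_nhds, fun _ => hv,
    tendsto_const_nhds⟩

theorem IsDesingularizing.monotoneOn {r : ℝ} {φ : ℝ → ℝ} (h : IsDesingularizing r φ) :
    MonotoneOn φ (Set.Ico 0 r) :=
  (strictMonoOn_of_deriv_pos (convex_Ico 0 r) h.continuousOn
    (by rw [interior_Ico]; exact h.deriv_pos)).monotoneOn

theorem IsDesingularizing.nonneg {r : ℝ} {φ : ℝ → ℝ} (h : IsDesingularizing r φ) {t : ℝ}
    (ht : t ∈ Set.Ico 0 r) : 0 ≤ φ t := by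
  rw [← h.map_zero]
  exact h.monotoneOn ⟨le_rfl, ht.1.trans_lt ht.2⟩ ht ht.1

theorem IsDesingularizing.deriv_mul_sub_le {r : ℝ} {φ : ℝ → ℝ} (h : IsDesingularizing r φ)
    {s t : ℝ} (hs : 0 ≤ s) (hst : s ≤ t) (ht0 : 0 < t) (ht : t < r) :
    deriv φ t * (t - s) ≤ φ t - φ s := by
  rcases hst.eq_or_lt with rfl | hst
  · simp
  have hd : DifferentiableAt ℝ φ t :=
    (h.contDiffOn.differentiableOn one_ne_zero).differentiableAt (Ioo_mem_nhds ht0 ht)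
  have h1 := h.concaveOn.deriv_le_slope ⟨hs, hst.trans ht⟩ ⟨ht0.le, ht⟩ hst hd
  rwa [slope_def_field, le_div_iff₀ (by linarith)] at h1

theorem two_mul_le_add_of_sq_le {p q D M : ℝ} (hp : 0 ≤ p) (hD : 0 ≤ M * D)
    (h : q ^ 2 ≤ p * (M * D)) : 2 * q ≤ p + M * D := by
  refine le_of_sq_le_sq ?_ (by positivity)
  nlinarith [sq_nonneg (p - M * D)]

/-- Convergence of descent sequences with relative errors under the Kurdyka-Lojasiewicz
property. -/
theorem tendsto_stationary_of_descent [FiniteDimensional ℝ E] {f : E → ℝ} (hf : Continuous f)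
    (hcoer : IsCoercive f) (hKL : IsKL f) {x : ℕ → E} {a b : ℝ} (ha : 0 < a) (hb : 0 < b)
    (hdesc : ∀ k, f (x (k + 1)) + a * ‖x (k + 1) - x k‖ ^ 2 ≤ f (x k))
    (hsub : ∀ k, ∃ v ∈ frechetSubdiff f (x (k + 1)), ‖v‖ ≤ b * ‖x (k + 1) - x k‖) :
    (∃ xs, Tendsto x atTop (𝓝 xs) ∧ IsStationary f xs) ∧
    Summable (fun k => ‖x (k + 1) - x k‖) ∧ Summable (fun k => ‖x (k + 1) - x k‖ ^ 2) := by
  have : ProperSpace E := FiniteDimensional.proper ℝ E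
  have hanti : Antitone fun k => f (x k) := by
    refine antitone_nat_of_succ_le fun k => ?_
    have := hdesc k
    nlinarith [sq_nonneg ‖x (k + 1) - x k‖]
  have hbdd : Bornology.IsBounded {y | f y ≤ f (x 0)} := by
    rw [← Bornology.isCobounded_compl_iff]
    filter_upwards [hcoer.2.eventually (eventually_gt_atTop (f (x 0)))] with y hy
    exact not_le.2 hy
  obtain ⟨xs, -, φ, hφ, hlim⟩ := tendsto_subseq_of_bounded hbdd
    (fun n => (hanti (Nat.zero_le n) : f (x n) ≤ f (x 0)))
  have hflim : Tendsto (fun k => f (x k)) atTop (𝓝 (f xs)) :=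
    (tendsto_iff_tendsto_subseq_of_antitone hanti hφ.tendsto_atTop).2 ((hf.tendsto xs).comp hlim)
  have hle : ∀ k, f xs ≤ f (x k) := fun k => hanti.le_of_tendsto hflim k
  have hsq : Summable (fun k => ‖x (k + 1) - x k‖ ^ 2) := by
    refine summable_of_sum_range_le (c := (f (x 0) - f xs) / a) (fun _ => sq_nonneg _) fun n => ?_
    rw [le_div_iff₀ ha]
    have : ∀ n, (∑ i ∈ Finset.range n, ‖x (i + 1) - x i‖ ^ 2) * a ≤ f (x 0) - f (x n) := by
      intro n
      induction n with
      | zero => simp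
      | succ n ih =>
        rw [Finset.sum_range_succ, add_mul]
        have := hdesc n
        linarith
    exact (this n).trans (by linarith [hle n])
  have hδ : Tendsto (fun k => ‖x (k + 1) - x k‖) atTop (𝓝 0) := by
    have := (hsq.tendsto_atTop_zero).sqrt
    simpa [Real.sqrt_sq] using this
  -- Stationarity of the cluster point comes before convergence of the whole sequence: it is what
  -- permits using the KL property at `xs`.
  have hstat : IsStationary f xs := by
    choose v hv hvn using hsub
    have hlim' : Tendsto (fun n => x (φ n + 1)) atTop (𝓝 xs) := by
      have h1 : Tendsto (fun n => x (φ n + 1) - x (φ n)) atTop (𝓝 0) :=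
        tendsto_zero_iff_norm_tendsto_zero.2 (hδ.comp hφ.tendsto_atTop)
      simpa using h1.add hlim
    refine ⟨fun n => x (φ n + 1), fun n => v (φ n), hlim', (hf.tendsto xs).comp hlim',
      fun n => hv _, ?_⟩
    refine squeeze_zero_norm (fun n => hvn (φ n)) ?_
    simpa using (hδ.comp hφ.tendsto_atTop).const_mul b
  obtain ⟨r, hr, ψ, hψ, hev⟩ := hKL xs ⟨0, hstat⟩
  obtain ⟨R, hR, hball⟩ := Metric.eventually_nhds_iff.1 hev
  set e : ℕ → ℝ := fun k => f (x k) - f xs with he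
  set δ : ℕ → ℝ := fun k => ‖x (k + 1) - x k‖ with hδdef
  have he0 : ∀ k, 0 ≤ e k := fun k => sub_nonneg.2 (hle k)
  have helim : Tendsto e atTop (𝓝 0) := by simpa using hflim.sub_const (f xs)
  have heanti : ∀ k, e (k + 1) ≤ e k := fun k => sub_le_sub_right (hanti k.le_succ) _
  -- KL at `x (k + 1)` gives `1 ≤ ψ'(e (k + 1)) b δ k`; decrease and concavity of `ψ` turn this into
  -- `δ (k + 1)² ≤ δ k · (b / a)(ψ(e (k + 1)) - ψ(e (k + 2)))`, and AM-GM makes it summable.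
  have hstep : ∀ k, dist (x (k + 1)) xs < R → e (k + 1) < r →
      2 * δ (k + 1) ≤ δ k + b / a * (ψ (e (k + 1)) - ψ (e (k + 2))) := by
    intro k hk hkr
    have hdk : a * δ (k + 1) ^ 2 ≤ e (k + 1) - e (k + 2) := by
      have := hdesc (k + 1)
      simp only [he, hδdef]
      linarith
    have hmono : 0 ≤ ψ (e (k + 1)) - ψ (e (k + 2)) :=
      sub_nonneg.2 (hψ.monotoneOn ⟨he0 _, (heanti _).trans_lt hkr⟩ ⟨he0 _, hkr⟩ (heanti _))
    refine two_mul_le_add_of_sq_le (norm_nonneg _) (mul_nonneg (by positivity) hmono) ?_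
    -- KL is available only strictly above the limit value; at the limit value the decrease forces a
    -- zero step.
    rcases (he0 (k + 1)).eq_or_lt with h0 | hpos
    · have h1 : δ (k + 1) ^ 2 ≤ 0 := by
        have := he0 (k + 2)
        by_contra! hlt
        nlinarith
      refine h1.trans (mul_nonneg (norm_nonneg _) (mul_nonneg (by positivity) hmono))
    obtain ⟨v, hv, hvn⟩ := hsub k
    have h1 := hball hk (by simpa [he] using hpos) (by simp only [he] at hkr; linarith) v
      (frechetSubdiff_subset_subdiff f _ hv)
    have hdpos := hψ.deriv_pos (e (k + 1)) ⟨hpos, hkr⟩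
    have h2 : 1 ≤ deriv ψ (e (k + 1)) * (b * δ k) :=
      h1.trans (mul_le_mul_of_nonneg_left hvn hdpos.le)
    have h3 := hψ.deriv_mul_sub_le (he0 (k + 2)) (heanti (k + 1)) hpos hkr
    have h4 : deriv ψ (e (k + 1)) * (a * δ (k + 1) ^ 2) ≤ ψ (e (k + 1)) - ψ (e (k + 2)) :=
      (mul_le_mul_of_nonneg_left hdk hdpos.le).trans h3
    have h5 : a * δ (k + 1) ^ 2 ≤ b * δ k * (ψ (e (k + 1)) - ψ (e (k + 2))) := by
      have hbδ : 0 ≤ b * δ k := mul_nonneg hb.le (norm_nonneg _)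
      calc a * δ (k + 1) ^ 2 ≤ (deriv ψ (e (k + 1)) * (b * δ k)) * (a * δ (k + 1) ^ 2) :=
            le_mul_of_one_le_left (by positivity) h2
        _ = b * δ k * (deriv ψ (e (k + 1)) * (a * δ (k + 1) ^ 2)) := by ring
        _ ≤ _ := mul_le_mul_of_nonneg_left h4 hbδ
    have h6 : δ k * (b / a * (ψ (e (k + 1)) - ψ (e (k + 2)))) =
        b * δ k * (ψ (e (k + 1)) - ψ (e (k + 2))) / a := by ring
    rw [h6, le_div_iff₀ ha]
    linarith
  have hψlim : Tendsto (fun k => ψ (e (k + 1))) atTop (𝓝 0) := by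
    have h1 : Tendsto ψ (𝓝[Set.Ico 0 r] 0) (𝓝 (ψ 0)) := hψ.continuousOn 0 ⟨le_rfl, hr⟩
    rw [hψ.map_zero] at h1
    refine h1.comp (tendsto_nhdsWithin_iff.2 ⟨helim.comp (tendsto_add_atTop_nat 1), ?_⟩)
    filter_upwards [(helim.comp (tendsto_add_atTop_nat 1)).eventually (gt_mem_nhds hr)] with k hk
    exact ⟨he0 _, hk⟩
  -- The budget for all later displacement from `xs`: one `δ` pays for the first step, the other and
  -- the `ψ` term for the remaining path. Choosing `N` with budget below `R` traps the tail in the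
  -- KL ball.
  have htotal : Tendsto (fun n => dist (x (φ n)) xs +
      (δ (φ n) + (δ (φ n) + b / a * ψ (e (φ n + 1))))) atTop (𝓝 0) := by
    have h1 := hδ.comp hφ.tendsto_atTop
    have h2 := (hψlim.comp hφ.tendsto_atTop).const_mul (b / a)
    simpa using (tendsto_iff_dist_tendsto_zero.1 hlim).add (h1.add (h1.add h2))
  obtain ⟨n, hn, hnr⟩ := ((htotal.eventually (gt_mem_nhds hR)).and
    ((helim.comp hφ.tendsto_atTop).eventually (gt_mem_nhds hr))).exists
  set N := φ n with hN
  have her : ∀ m, e (N + m) < r := by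
    intro m
    refine lt_of_le_of_lt ?_ hnr
    exact sub_le_sub_right (hanti (Nat.le_add_right N m)) _
  have hpath : ∀ m, dist (x (N + 1 + m)) xs ≤
      dist (x N) xs + (δ N + ∑ i ∈ Finset.range m, δ (N + 1 + i)) := by
    intro m
    induction m with
    | zero =>
      have h1 := dist_triangle (x (N + 1)) (x N) xs
      rw [dist_eq_norm _ (x N)] at h1
      simp only [hδdef, add_zero, Finset.range_zero, Finset.sum_empty]
      linarith
    | succ m ih =>
      have h1 := dist_triangle (x (N + 1 + m + 1)) (x (N + 1 + m)) xs
      rw [dist_eq_norm _ (x (N + 1 + m))] at h1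
      rw [Finset.sum_range_succ, ← add_assoc (N + 1)]
      have h2 : δ (N + 1 + m) = ‖x (N + 1 + m + 1) - x (N + 1 + m)‖ := rfl
      linarith
  -- The extra `δ (N + m)` is the term that the next use of `hstep` consumes. The induction
  -- hypothesis also keeps the next iterate in the ball, through `hpath`.
  have hsum : ∀ m, ∑ i ∈ Finset.range m, δ (N + 1 + i) + δ (N + m) ≤
      δ N + b / a * (ψ (e (N + 1)) - ψ (e (N + 1 + m))) := by
    intro m
    induction m with
    | zero => simp
    | succ m ih =>
      have hψ0 : 0 ≤ b / a * ψ (e (N + 1 + m)) :=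
        mul_nonneg (by positivity) (hψ.nonneg ⟨he0 _, by rw [add_assoc]; exact her _⟩)
      have hin : dist (x (N + m + 1)) xs < R := by
        have h1 := hpath m
        rw [show N + m + 1 = N + 1 + m by ring]
        have h2 : 0 ≤ δ (N + m) := norm_nonneg _
        rw [mul_sub] at ih
        linarith
      have h3 := hstep (N + m) hin (her (m + 1))
      rw [Finset.sum_range_succ]
      rw [show N + m + 2 = N + 1 + (m + 1) by ring, show N + m + 1 = N + 1 + m by ring] at h3
      rw [show N + (m + 1) = N + 1 + m by ring]
      rw [mul_sub] at h3 ih ⊢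
      linarith
  have hsummable : Summable δ := by
    rw [← summable_nat_add_iff (N + 1)]
    refine summable_of_sum_range_le (c := δ N + b / a * ψ (e (N + 1))) (fun _ => norm_nonneg _)
      fun m => ?_
    have h1 := hsum m
    have hψ0 : 0 ≤ b / a * ψ (e (N + 1 + m)) :=
      mul_nonneg (by positivity) (hψ.nonneg ⟨he0 _, by rw [add_assoc]; exact her _⟩)
    have h2 : 0 ≤ δ (N + m) := norm_nonneg _
    rw [mul_sub] at h1
    simp only [add_comm _ (N + 1)]
    linarith
  refine ⟨⟨xs, ?_, hstat⟩, hsummable, hsq⟩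
  have hc : CauchySeq x := cauchySeq_of_summable_dist (by
    simpa only [hδdef, dist_eq_norm, norm_sub_rev (x (_ + 1))] using hsummable)
  obtain ⟨y, hy⟩ := cauchySeq_tendsto_of_complete hc
  rwa [tendsto_nhds_unique hlim (hy.comp hφ.tendsto_atTop)]

end Descent

/-! ### Smooth functions: descent lemma and sum rule. -/

section Smooth

variable {E : Type*} [NormedAddCommGroup E] [InnerProductSpace ℝ E] [CompleteSpace E]

/-- The descent lemma for functions with Lipschitz gradient. -/
theorem le_add_of_gradient_lipschitz {L : E → ℝ} (hL : Differentiable ℝ L) {C : ℝ}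
    (hLip : ∀ X Y, ‖gradient L X - gradient L Y‖ ≤ C * ‖X - Y‖) (X Y : E) :
    L Y ≤ L X + inner ℝ (gradient L X) (Y - X) + C / 2 * ‖Y - X‖ ^ 2 := by
  set D := Y - X with hD
  -- The Lipschitz bound makes the derivative of `g` nonpositive on `(0, 1)`; the claim is `g 1 ≤ g
  -- 0`.
  set g : ℝ → ℝ := fun t =>
    L (X + t • D) - t * inner ℝ (gradient L X) D - C / 2 * t ^ 2 * ‖D‖ ^ 2 with hg
  have hder : ∀ t, HasDerivAt g (inner ℝ (gradient L (X + t • D)) D - inner ℝ (gradient L X) D -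
      C * t * ‖D‖ ^ 2) t := by
    intro t
    have h1 : HasDerivAt (fun t : ℝ => X + t • D) D t := by
      simpa using ((hasDerivAt_id t).smul_const D).const_add X
    have h2 := ((hL (X + t • D)).hasGradientAt.hasFDerivAt).comp_hasDerivAt t h1
    have h3 := ((hasDerivAt_id t).mul_const (inner ℝ (gradient L X) D))
    have h4 := (((hasDerivAt_id t).pow 2).const_mul (C / 2)).mul_const (‖D‖ ^ 2)
    convert! (h2.sub h3).sub h4 using 1
    simp only [InnerProductSpace.toDual_apply_apply, id, one_mul, Nat.cast_ofNat, mul_one]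
    ring
  have hanti : AntitoneOn g (Set.Icc 0 1) := by
    refine antitoneOn_of_deriv_nonpos (convex_Icc 0 1)
      (fun t _ => (hder t).continuousAt.continuousWithinAt)
      (fun t _ => (hder t).differentiableAt.differentiableWithinAt) fun t ht => ?_
    rw [interior_Icc] at ht
    rw [(hder t).deriv, ← inner_sub_left]
    have h1 := real_inner_le_norm (gradient L (X + t • D) - gradient L X) D
    have h2 := hLip (X + t • D) X
    rw [add_sub_cancel_left, norm_smul, Real.norm_eq_abs, abs_of_pos ht.1] at h2
    have h3 := mul_le_mul_of_nonneg_right h2 (norm_nonneg D)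
    nlinarith
  have h := hanti (Set.left_mem_Icc.2 zero_le_one) (Set.right_mem_Icc.2 zero_le_one) zero_le_one
  simp only [hg, one_smul, zero_smul, add_zero, hD, add_sub_cancel] at h
  linarith

/-- The sum of a gradient and a proximal subgradient is a regular subgradient of the sum. -/
theorem gradient_add_mem_frechetSubdiff {f h : E → ℝ} {X Z : E} {c : ℝ}
    (hf : DifferentiableAt ℝ f X)
    (hh : ∀ Y, h X + inner ℝ Z (Y - X) - c * ‖Y - X‖ ^ 2 ≤ h Y) :
    gradient f X + Z ∈ frechetSubdiff (fun Y => f Y + h Y) X := by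
  intro ε hε
  have hd := (hasFDerivAt_iff_isLittleO.1 hf.hasGradientAt.hasFDerivAt).def (half_pos hε)
  have hc : ∀ᶠ Y in 𝓝 X, |c| * ‖Y - X‖ < ε / 2 := by
    have h1 : Tendsto (fun Y => |c| * ‖Y - X‖) (𝓝 X) (𝓝 (|c| * ‖X - X‖)) :=
      Continuous.tendsto (by fun_prop) X
    rw [sub_self, norm_zero, mul_zero] at h1
    exact h1.eventually (gt_mem_nhds (half_pos hε))
  filter_upwards [hd, hc] with Y h1 h2
  rw [InnerProductSpace.toDual_apply_apply, Real.norm_eq_abs] at h1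
  have h3 := (abs_le.1 h1).1
  have h4 := hh Y
  have h5 : c * ‖Y - X‖ ^ 2 ≤ ε / 2 * ‖Y - X‖ := by
    nlinarith [norm_nonneg (Y - X), le_abs_self c, sq_nonneg ‖Y - X‖]
  rw [inner_add_left]
  linarith

end Smooth

/-! ### The thresholding update: model decrease and subgradient bound. -/

section Update

variable {d d₃ : ℕ} [NeZero d₃]

theorem IsSVD.add {A B U V : Matrix (Fin d) (Fin d) ℂ} {a b : Fin d → ℝ} (hA : IsSVD A U a V)
    (hB : IsSVD B U b V) : IsSVD (A + B) U (fun i => a i + b i) V := by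
  refine ⟨hA.left_mem, hA.right_mem, ?_⟩
  rw [hA.eq, hB.eq, ← Matrix.add_mul, ← Matrix.mul_add, Matrix.diagonal_add]
  simp

theorem IsSVD.smul {A U V : Matrix (Fin d) (Fin d) ℂ} {a : Fin d → ℝ} (hA : IsSVD A U a V)
    (r : ℝ) : IsSVD ((r : ℂ) • A) U (fun i => r * a i) V := by
  refine ⟨hA.left_mem, hA.right_mem, ?_⟩
  rw [hA.eq, ← Matrix.smul_mul, ← Matrix.mul_smul, ← Matrix.diagonal_smul]
  congr 3
  ext i
  simp

theorem IsSVD.sub {A B U V : Matrix (Fin d) (Fin d) ℂ} {a b : Fin d → ℝ} (hA : IsSVD A U a V)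
    (hB : IsSVD B U b V) : IsSVD (A - B) U (fun i => a i - b i) V := by
  refine ⟨hA.left_mem, hA.right_mem, ?_⟩
  rw [hA.eq, hB.eq, ← Matrix.sub_mul, ← Matrix.mul_sub, Matrix.diagonal_sub]
  simp

theorem sliceInner_add_left (A B C : ZMod d₃ → Matrix (Fin d) (Fin d) ℂ) :
    sliceInner (fun j => A j + B j) C = sliceInner A C + sliceInner B C := by
  simp only [sliceInner, frob_comm _ (C _), frob_add_right, Finset.sum_add_distrib, mul_add]

/-- The scalar lower bounds are summed over the singular values. The quadratic terms combine into
Frobenius norms, leaving the pairing of `z + μ σ(X)` with `σ(Y)`, which the trace inequality bounds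
below by the pairing of `A + μ X` with `Y`. Only `z + μ σ(X)` has to be sorted, not `z`. -/
theorem tensorPenalty_ge {ρ : ℝ → ℝ} {μ : ℝ} (hμ : 0 < μ) {X : Tensor d d₃}
    {A U V : ZMod d₃ → Matrix (Fin d) (Fin d) ℂ} {z : Fin d → ZMod d₃ → ℝ}
    (hX : ∀ j, IsSVD (fourierSlice X j) (U j) (fun i => sv X i j) (V j))
    (hA : ∀ j, IsSVD (A j) (U j) (fun i => z i j) (V j)) (hz0 : ∀ i j, 0 ≤ z i j)
    (hz : ∀ j, Antitone fun i => z i j + μ * sv X i j)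
    (hlow : ∀ i j s, 0 ≤ s →
      ρ (sv X i j) + z i j * (s - sv X i j) - μ / 2 * (s - sv X i j) ^ 2 ≤ ρ s)
    (Y : Tensor d d₃) :
    tensorPenalty ρ X + sliceInner A (fourierSlice (Y - X)) - μ / 2 * ‖Y - X‖ ^ 2 ≤
      tensorPenalty ρ Y := by
  choose U' V' hY using exists_isSVD_sv Y
  have hμX : ∀ j, IsSVD (fourierSlice (μ • X) j) (U j) (fun i => μ * sv X i j) (V j) := by
    intro j
    rw [fourierSlice_smul]
    exact (hX j).smul μ
  have hA' := fun j => (hA j).add (hμX j)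
  have h1 := sliceInner_le_of_isSVD hA' hY hz (sv_antitone Y)
    (fun i j => add_nonneg (hz0 i j) (mul_nonneg hμ.le (sv_nonneg X i j))) (sv_nonneg Y)
  have h2 := sliceInner_of_isSVD hA' hX
  have h3 : sliceInner A (fourierSlice (Y - X)) =
      sliceInner A (fourierSlice Y) - sliceInner A (fourierSlice X) := by
    have := fun j => frob_add_right (A j) (fourierSlice (Y - X) j) (fourierSlice X j)
    simp only [← fourierSlice_add, sub_add_cancel] at this
    simp only [sliceInner, this, Finset.sum_add_distrib]
    ring
  rw [sliceInner_add_left, sliceInner_fourierSlice, real_inner_smul_left] at h1 h2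
  rw [real_inner_self_eq_norm_sq] at h2
  have h4 := avgSum_mono (fun i j => hlow i j (sv Y i j) (sv_nonneg Y i j))
  have h5 : avgSum (fun i j => ρ (sv X i j) + z i j * (sv Y i j - sv X i j) -
      μ / 2 * (sv Y i j - sv X i j) ^ 2) = tensorPenalty ρ X +
      avgSum (fun i j => (z i j + μ * sv X i j) * sv Y i j) +
      (-1) * avgSum (fun i j => (z i j + μ * sv X i j) * sv X i j) +
      (-(μ / 2)) * avgSum (fun i j => sv Y i j * sv Y i j) +
      μ / 2 * avgSum (fun i j => sv X i j * sv X i j) := by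
    rw [tensorPenalty_eq_avgSum]
    simp only [← avgSum_const_mul, ← avgSum_add]
    congr 1
    ext i j
    ring
  rw [h5, ← tensorPenalty_eq_avgSum, avgSum_sv_sq, avgSum_sv_sq] at h4
  have h6 := norm_sub_sq_real Y X
  rw [real_inner_comm] at h6
  rw [h3, h6]
  linarith

/-- Soft thresholding minimizes the scalar proximal objective over `y ≥ 0`; complete the square in
the active case. -/
theorem soft_threshold_le {g τ y : ℝ} (hy : 0 ≤ y) :
    1 / 2 * (max (g - τ) 0 - g) ^ 2 + τ * max (g - τ) 0 ≤ 1 / 2 * (y - g) ^ 2 + τ * y := by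
  rcases max_cases (g - τ) 0 with ⟨h, h'⟩ | ⟨h, h'⟩ <;> rw [h]
  · nlinarith [sq_nonneg (y - g + τ)]
  · nlinarith [sq_nonneg y]

/-- Singular value thresholding is a proximal step for the weighted nuclear norm. -/
theorem IsWtSVT.prox_le {G X : Tensor d d₃} {τ : Fin d → ZMod d₃ → ℝ} (h : IsWtSVT G τ X)
    (hτ : ∀ j, Monotone fun i => τ i j) (Y : Tensor d d₃) :
    1 / 2 * ‖X - G‖ ^ 2 + avgSum (fun i j => τ i j * sv X i j) ≤
      1 / 2 * ‖Y - G‖ ^ 2 + avgSum (fun i j => τ i j * sv Y i j) := by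
  obtain ⟨⟨U, V, hG, hX⟩, hsv⟩ := h.exists_isSVD hτ
  have hXG : ‖X - G‖ ^ 2 = avgSum fun i j => (sv X i j - sv G i j) ^ 2 := by
    have hd : ∀ j, IsSVD (fourierSlice (X - G) j) (U j) (fun i => sv X i j - sv G i j) (V j) := by
      intro j
      rw [fourierSlice_sub]
      exact (hX j).sub (hG j)
    rw [← sliceInner_fourierSlice_self, sliceInner_of_isSVD hd hd]
    simp only [sq]
  -- Mirsky reduces the competitor `Y` to its singular values; for `X`, which shares singular
  -- vectors with `G`, the reduction is exact.
  have hYG := avgSum_sv_sub_sq_le Y G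
  have hmono := avgSum_mono (d := d) (d₃ := d₃) fun i j =>
    soft_threshold_le (g := sv G i j) (τ := τ i j) (sv_nonneg Y i j)
  simp only [← hsv] at hmono
  rw [avgSum_add, avgSum_add, avgSum_const_mul, avgSum_const_mul, ← hXG] at hmono
  linarith

variable {L : Tensor d d₃ → ℝ} {ρ : ℝ → ℝ} {C Cl μ η : ℝ} {W : Fin d → ZMod d₃ → ℝ}
  {T X : Tensor d d₃}

theorem IsWeight.eq_penaltyDeriv (hρ : IsPenalty ρ) (hC : Tendsto (deriv ρ) (𝓝[>] 0) (𝓝 C))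
    (hW : IsWeight ρ T W) (i : Fin d) (j : ZMod d₃) : W i j = penaltyDeriv ρ C (sv T i j) :=
  hρ.weight_eq hC (sv_nonneg T i j) (hW i j).1 (hW i j).2

/-- Concavity gives smaller weights to larger singular values; this order is what makes thresholding
an exact proximal step. -/
theorem IsWeight.monotone (hρ : IsPenalty ρ) (hC : Tendsto (deriv ρ) (𝓝[>] 0) (𝓝 C))
    (hW : IsWeight ρ T W) (j : ZMod d₃) : Monotone fun i => W i j := by
  intro i₁ i₂ h
  simp only [hW.eq_penaltyDeriv hρ hC]
  exact hρ.penaltyDeriv_anti hC (sv_nonneg T i₂ j) (sv_antitone T j h)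

theorem IsWeight.monotone_mul (hρ : IsPenalty ρ) (hC : Tendsto (deriv ρ) (𝓝[>] 0) (𝓝 C))
    (hW : IsWeight ρ T W) (hη : 0 < η) (j : ZMod d₃) : Monotone fun i => 1 / η * W i j :=
  fun _ _ h => mul_le_mul_of_nonneg_left (hW.monotone hρ hC j h) (by positivity)

/-- The update decreases the majorizing model. -/
theorem IsUpdate.model_le (hρ : IsPenalty ρ) (hC : Tendsto (deriv ρ) (𝓝[>] 0) (𝓝 C))
    (hW : IsWeight ρ T W) (hη : 0 < η) (h : IsUpdate L W η T X) :
    inner ℝ (gradient L T) (X - T) + η / 2 * ‖X - T‖ ^ 2 +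
      avgSum (fun i j => W i j * sv X i j) ≤ avgSum (fun i j => W i j * sv T i j) := by
  have h1 := IsWtSVT.prox_le h (hW.monotone_mul hρ hC hη) T
  simp only [mul_assoc] at h1
  rw [avgSum_const_mul, avgSum_const_mul] at h1
  have e1 : X - (T - (1 / η) • gradient L T) = (X - T) + (1 / η) • gradient L T := by abel
  have e2 : T - (T - (1 / η) • gradient L T) = (1 / η) • gradient L T := by abel
  rw [e1, e2, norm_add_sq_real, inner_smul_right, real_inner_comm] at h1
  have h2 := mul_le_mul_of_nonneg_left h1 hη.le
  field_simp at h2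
  linarith

/-- Trials with a large parameter are accepted. -/
theorem IsUpdate.searchCriterion (hρ : IsPenalty ρ) (hC : Tendsto (deriv ρ) (𝓝[>] 0) (𝓝 C))
    (hL : Differentiable ℝ L) (hCl : 0 < Cl)
    (hLip : ∀ X Y, ‖gradient L X - gradient L Y‖ ≤ Cl * ‖X - Y‖)
    {α : ℝ} (hα : α < 1) (hη : Cl / (1 - α) ≤ η)
    (hW : IsWeight ρ T W) (h : IsUpdate L W η T X) : SearchCriterion L ρ α η T X := by
  have hα' : 0 < 1 - α := by linarith
  have hη0 : 0 < η := (div_pos hCl hα').trans_le hη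
  rw [div_le_iff₀ hα'] at hη
  have h1 := h.model_le hρ hC hW hη0
  have h2 := le_add_of_gradient_lipschitz hL hLip T X
  have h3 := avgSum_mono (fun i j => (hW i j).2 (sv X i j) (sv_nonneg X i j))
  have h4 : avgSum (fun i j => ρ (sv T i j) + W i j * (sv X i j - sv T i j)) =
      tensorPenalty ρ T + avgSum (fun i j => W i j * sv X i j) +
      (-1) * avgSum (fun i j => W i j * sv T i j) := by
    rw [tensorPenalty_eq_avgSum]
    simp only [← avgSum_const_mul, ← avgSum_add]
    congr 1
    ext i j
    ring
  rw [h4, ← tensorPenalty_eq_avgSum] at h3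
  -- The lower bound on `η` says `η - Cl ≥ α η`: the model decrease absorbs the descent-lemma error
  -- and leaves the required margin.
  have h5 : (Cl - η + α * η) / 2 * ‖X - T‖ ^ 2 ≤ 0 :=
    mul_nonpos_of_nonpos_of_nonneg (by nlinarith) (sq_nonneg _)
  simp only [SearchCriterion, objective]
  nlinarith

/-- The relative error bound for regular subgradients at an update. -/
theorem IsUpdate.exists_frechetSubdiff (hρ : IsPenalty ρ)
    (hC : Tendsto (deriv ρ) (𝓝[>] 0) (𝓝 C)) (hμ0 : 0 < μ)
    (hμ : ConvexOn ℝ Set.univ (fun x => ρ x + μ / 2 * x ^ 2))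
    (hL : Differentiable ℝ L)
    (hLip : ∀ X Y, ‖gradient L X - gradient L Y‖ ≤ Cl * ‖X - Y‖) (hη : 0 < η)
    (hW : IsWeight ρ T W) (h : IsUpdate L W η T X) :
    ∃ v ∈ frechetSubdiff (objective L ρ) X, ‖v‖ ≤ (Cl + η + μ) * ‖X - T‖ := by
  set G := T - (1 / η) • gradient L T with hGdef
  obtain ⟨⟨U, V, hG, hX⟩, hsv⟩ := IsWtSVT.exists_isSVD h (hW.monotone_mul hρ hC hη)
  -- The correction from weights at `T` to derivatives at `X`. No correction is needed where `σ(X) =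
  -- 0`, since any value in `[0, C]` is admissible there.
  set δ : Fin d → ZMod d₃ → ℝ := fun i j =>
    if 0 < sv X i j then penaltyDeriv ρ C (sv X i j) - W i j else 0 with hδ
  let Δ : ZMod d₃ → Matrix (Fin d) (Fin d) ℂ := fun j =>
    U j * Matrix.diagonal (fun i => ((δ i j : ℝ) : ℂ)) * (V j).conjTranspose
  have hΔ : ∀ j, IsSVD (Δ j) (U j) (fun i => δ i j) (V j) :=
    fun j => ⟨(hG j).left_mem, (hG j).right_mem, rfl⟩
  obtain ⟨Z, hZ, hZn⟩ := exists_tensor_inner_eq Δ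
  have hZle : ‖Z‖ ≤ μ * ‖X - T‖ := by
    refine le_of_sq_le_sq ?_ (by positivity)
    rw [sliceInner_of_isSVD hΔ hΔ] at hZn
    refine hZn.trans (le_trans (avgSum_mono (b := fun i j =>
      μ ^ 2 * (sv X i j - sv T i j) ^ 2) fun i j => ?_) ?_)
    · rw [← mul_pow, ← sq]
      rw [sq_le_sq, abs_mul, abs_of_pos hμ0]
      simp only [hδ]
      split_ifs
      · rw [hW.eq_penaltyDeriv hρ hC]
        exact hρ.abs_penaltyDeriv_sub_le hC hμ0 hμ (sv_nonneg X i j) (sv_nonneg T i j)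
      · rw [abs_zero]
        positivity
    · rw [avgSum_const_mul, mul_pow]
      exact mul_le_mul_of_nonneg_left (avgSum_sv_sub_sq_le X T) (by positivity)
  set z : Fin d → ZMod d₃ → ℝ := fun i j => η * (sv G i j - sv X i j) + δ i j with hz
  have hA : ∀ j, IsSVD (fourierSlice (η • (G - X)) j + Δ j) (U j) (fun i => z i j) (V j) := by
    intro j
    rw [fourierSlice_smul, fourierSlice_sub]
    exact (((hG j).sub (hX j)).smul η).add (hΔ j)
  have hzpos : ∀ i j, 0 < sv X i j → z i j = penaltyDeriv ρ C (sv X i j) := by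
    intro i j hpos
    have h1 := hsv i j
    rcases max_cases (sv G i j - 1 / η * W i j) 0 with ⟨h2, -⟩ | ⟨h2, -⟩
    · rw [h2] at h1
      simp only [hz, hδ, if_pos hpos]
      rw [show sv G i j - sv X i j = 1 / η * W i j by linarith]
      field_simp
      ring
    · rw [h2] at h1
      exact absurd h1 hpos.ne'
  have hzzero : ∀ i j, sv X i j = 0 → z i j = η * sv G i j ∧ z i j ≤ C := by
    intro i j h0
    have h3 : z i j = η * sv G i j := by simp [hz, hδ, h0]
    refine ⟨h3, ?_⟩
    have h1 : sv G i j - 1 / η * W i j ≤ 0 := by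
      rw [← h0, hsv i j]; exact le_max_left _ _
    have h2 : W i j ≤ C := by
      rw [hW.eq_penaltyDeriv hρ hC, ← penaltyDeriv_zero ρ C]
      have := hρ.penaltyDeriv_anti hC le_rfl (sv_nonneg T i j)
      rwa [penaltyDeriv_zero] at this ⊢
    rw [h3]
    have h4 := mul_le_mul_of_nonneg_left h1 hη.le
    field_simp at h4
    linarith
  have hz0 : ∀ i j, 0 ≤ z i j := by
    intro i j
    rcases (sv_nonneg X i j).eq_or_lt with h0 | hpos
    · rw [(hzzero i j h0.symm).1]
      exact mul_nonneg hη.le (sv_nonneg G i j)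
    · rw [hzpos i j hpos]
      exact hρ.penaltyDeriv_nonneg hC _
  -- Within the positive block weak convexity gives the order, within the zero block the order of
  -- `σ(G)` does, and across the two the bound `z ≤ C` from `hzzero` together with `C ≤ ρ'(σ) + μ
  -- σ`.
  have hzanti : ∀ j, Antitone fun i => z i j + μ * sv X i j := by
    intro j i₁ i₂ h12
    have hX12 := sv_antitone X j h12
    simp only at hX12 ⊢
    rcases (sv_nonneg X i₂ j).eq_or_lt with h0 | hpos
    · rcases (sv_nonneg X i₁ j).eq_or_lt with h0' | hpos'
      · rw [(hzzero i₁ j h0'.symm).1, (hzzero i₂ j h0.symm).1, ← h0, ← h0']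
        have := mul_le_mul_of_nonneg_left (sv_antitone G j h12) hη.le
        linarith
      · rw [hzpos i₁ j hpos', ← h0]
        have h1 := (hzzero i₂ j h0.symm).2
        have h2 := hρ.penaltyDeriv_sub_le hC hμ0 hμ le_rfl hpos'.le
        rw [penaltyDeriv_zero] at h2
        linarith
    · rw [hzpos i₂ j hpos, hzpos i₁ j (hpos.trans_le hX12)]
      have h2 := hρ.penaltyDeriv_sub_le hC hμ0 hμ hpos.le hX12
      linarith
  have hlow : ∀ i j s, 0 ≤ s →
      ρ (sv X i j) + z i j * (s - sv X i j) - μ / 2 * (s - sv X i j) ^ 2 ≤ ρ s := by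
    intro i j s hs
    have h1 := hρ.lower_bound hC hμ (sv_nonneg X i j) s
    rcases (sv_nonneg X i j).eq_or_lt with h0 | hpos
    · have h2 := (hzzero i j h0.symm).2
      rw [← h0, penaltyDeriv_zero] at h1
      rw [← h0]
      nlinarith
    · rwa [hzpos i j hpos]
  refine ⟨gradient L X + (η • (G - X) + Z), ?_, ?_⟩
  · refine gradient_add_mem_frechetSubdiff (c := μ / 2) (hL X) fun Y => ?_
    have h1 := tensorPenalty_ge hμ0 hX hA hz0 hzanti hlow Y
    rwa [sliceInner_add_left, sliceInner_fourierSlice, ← hZ, ← inner_add_left] at h1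
  -- Since `η (G - X) = -η (X - T) - ∇L(T)`, the three summands are bounded with the constants `Cl`,
  -- `η` and `μ`.
  · have e1 : gradient L X + (η • (G - X) + Z) =
        (gradient L X - gradient L T) + (-η) • (X - T) + Z := by
      rw [hGdef, smul_sub, smul_sub, smul_smul, mul_one_div_cancel hη.ne', one_smul, smul_sub,
        neg_smul, neg_smul]
      abel
    rw [e1]
    refine (norm_add_le _ _).trans ?_
    have h1 := norm_add_le (gradient L X - gradient L T) ((-η) • (X - T))
    rw [norm_smul, norm_neg, Real.norm_eq_abs, abs_of_pos hη] at h1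
    have h2 := hLip X T
    linarith

theorem continuous_objective (hρ : IsPenalty ρ) (hL : Differentiable ℝ L) :
    Continuous (objective L ρ) := by
  refine hL.continuous.add (continuous_const.mul ?_)
  refine continuous_finsetSum _ fun i _ => continuous_finsetSum _ fun j _ => ?_
  exact hρ.continuousOn.comp_continuous (continuous_sv i j) fun T => sv_nonneg T i j

/-- Cauchy-Schwarz and the Lipschitz gradient. For `S = T` the quotient is `0 / 0 = 0`, still within
the bound. -/
theorem barzilaiBorwein_le (hCl : 0 < Cl)
    (hLip : ∀ X Y, ‖gradient L X - gradient L Y‖ ≤ Cl * ‖X - Y‖) (S T : Tensor d d₃) :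
    barzilaiBorwein L S T ≤ Cl := by
  rw [barzilaiBorwein, real_inner_self_eq_norm_sq]
  refine div_le_of_le_mul₀ (sq_nonneg _) hCl.le ?_
  have h1 := real_inner_le_norm (T - S) (gradient L T - gradient L S)
  have h2 := mul_le_mul_of_nonneg_left (hLip T S) (norm_nonneg (T - S))
  nlinarith

end Update

/-! ### Step size bounds and the stopping rule. -/

section Algorithm

variable {d d₃ : ℕ} [NeZero d₃] {L : Tensor d d₃ → ℝ} {ρ : ℝ → ℝ} {C Cl κ α η₀ ηmin : ℝ}
  {B : ℕ → Tensor d d₃} {η : ℕ → ℝ}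

theorem IsGenerated.step_zero_pos (hB : IsGenerated L ρ κ α η₀ ηmin B η) (hκ : 0 < κ)
    (hη₀ : 0 < η₀) : 0 < η 0 := by
  obtain ⟨W, -, m, hm, -⟩ := (hB 0).1 fun l hl => absurd hl l.not_lt_zero
  rw [hm]
  exact mul_pos (pow_pos hκ m) hη₀

/-- The backtracking steps are bounded. -/
theorem IsIteration.step_le {k : ℕ} (h : IsIteration L ρ κ α η₀ ηmin B η k) (hρ : IsPenalty ρ)
    (hC : Tendsto (deriv ρ) (𝓝[>] 0) (𝓝 C)) (hL : Differentiable ℝ L) (hCl : 0 < Cl)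
    (hLip : ∀ X Y, ‖gradient L X - gradient L Y‖ ≤ Cl * ‖X - Y‖) (hκ : 0 < κ) (hα : α < 1)
    (hk : 0 < k) : η k ≤ max (max Cl ηmin) (κ * (Cl / (1 - α))) := by
  obtain ⟨W, hW, m, hm, -, -, hrej⟩ := h
  rcases m with - | m
  · refine le_trans ?_ (le_max_left _ _)
    obtain ⟨k, rfl⟩ := Nat.exists_eq_succ_of_ne_zero hk.ne'
    rw [hm, pow_zero, one_mul]
    exact max_le_max_right _ (barzilaiBorwein_le hCl hLip _ _)
  · refine le_trans ?_ (le_max_right _ _)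
    -- The last rejected trial: had its parameter reached `Cl / (1 - α)`, it would have been
    -- accepted.
    obtain ⟨X, hX, hnot⟩ := hrej m m.lt_succ_self
    have hlt : κ ^ m * initStep L η₀ ηmin B k < Cl / (1 - α) := by
      by_contra! hle
      exact hnot (hX.searchCriterion hρ hC hL hCl hLip hα hle hW)
    rw [hm, pow_succ', mul_assoc]
    exact mul_le_mul_of_nonneg_left hlt.le hκ.le

/-- Either the algorithm iterates, or it has stopped after an iteration without progress. -/
theorem IsGenerated.iteration_or_stopped (hB : IsGenerated L ρ κ α η₀ ηmin B η) (k : ℕ) :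
    IsIteration L ρ κ α η₀ ηmin B η k ∨ (B (k + 1) = B k ∧
      ∃ l, IsIteration L ρ κ α η₀ ηmin B η l ∧ B (l + 1) = B l ∧ B (l + 1) = B (k + 1)) := by
  classical
  by_cases h : ∃ l < k, B (l + 1) = B l
  · right
    have hex : ∃ l, B (l + 1) = B l := h.imp fun _ => And.right
    obtain ⟨l₀, hl₀, heq₀⟩ := h
    have hlk : Nat.find hex < k := (Nat.find_min' hex heq₀).trans_lt hl₀
    -- The first index without progress is still a genuine iteration, because no coincidence
    -- precedes it.
    refine ⟨(hB k).2 ⟨l₀, hl₀, heq₀⟩, Nat.find hex,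
      (hB _).1 fun l hl => Nat.find_min hex hl, Nat.find_spec hex, ?_⟩
    have hconst : ∀ n, B (Nat.find hex + 1 + n) = B (Nat.find hex + 1) := by
      intro n
      induction n with
      | zero => rfl
      | succ n ih =>
        rw [← ih]
        exact (hB (Nat.find hex + 1 + n)).2 ⟨Nat.find hex, by omega, Nat.find_spec hex⟩
    rw [← hconst (k - Nat.find hex), show Nat.find hex + 1 + (k - Nat.find hex) = k + 1 by omega]
  · left
    push Not at h
    exact (hB k).1 h

end Algorithm

end TensorReg

end

/-! ### Assembly of the convergence theorem. -/

theorem mainTheorem3 (d d₃ : ℕ) [NeZero d₃]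
    (L : TensorReg.Tensor d d₃ → ℝ) (ρ : ℝ → ℝ)
    (hρ : TensorReg.IsPenalty ρ)
    (hL : Differentiable ℝ L)
    (Cl : ℝ) (hCl : 0 < Cl)
    (hLip : ∀ X Y, ‖gradient L X - gradient L Y‖ ≤ Cl * ‖X - Y‖)
    (hcoer : TensorReg.IsCoercive (TensorReg.objective L ρ))
    (hKL : TensorReg.IsKL (TensorReg.objective L ρ))
    (κ α η₀ ηmin : ℝ) (hκ : 1 < κ) (hα0 : 0 < α) (hα1 : α < 1) (hη₀ : 0 < η₀)
    (B : ℕ → TensorReg.Tensor d d₃) (η : ℕ → ℝ)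
    (hB : TensorReg.IsGenerated L ρ κ α η₀ ηmin B η)
    (hη : ∀ k, 0 < k → Cl / (1 - α) ≤ η k) :
    (∃ Bstar : TensorReg.Tensor d d₃,
      Tendsto B atTop (𝓝 Bstar) ∧ TensorReg.IsStationary (TensorReg.objective L ρ) Bstar) ∧
    Summable (fun k => ‖B (k + 1) - B k‖) ∧
    Summable (fun k => ‖B (k + 1) - B k‖ ^ 2) := by
  obtain ⟨C, hC⟩ := hρ.deriv_tendsto
  obtain ⟨μ, hμ0, hμ⟩ := hρ.weaklyConvex
  have hc : 0 < Cl / (1 - α) := div_pos hCl (by linarith)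
  have hη0 : 0 < η 0 := hB.step_zero_pos (by linarith) hη₀
  have hpos : ∀ k, min (η 0) (Cl / (1 - α)) ≤ η k := by
    intro k
    rcases k.eq_zero_or_pos with rfl | hk
    · exact min_le_left _ _
    · exact (min_le_right _ _).trans (hη k hk)
  have hηpos : ∀ k, 0 < η k := fun k => (lt_min hη0 hc).trans_le (hpos k)
  set H := max (η 0) (max (max Cl ηmin) (κ * (Cl / (1 - α)))) with hH
  -- Restricted to genuine iterations: after stopping, the algorithm does not determine `η k`. The
  -- value `η 0` enters `H` as a fixed number.
  have hbound : ∀ k, TensorReg.IsIteration L ρ κ α η₀ ηmin B η k → η k ≤ H := by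
    intro k hk
    rcases k.eq_zero_or_pos with rfl | hk0
    · exact le_max_left _ _
    · exact (hk.step_le hρ hC hL hCl hLip (by linarith) hα1 hk0).trans (le_max_right _ _)
  refine TensorReg.tendsto_stationary_of_descent (a := α / 2 * min (η 0) (Cl / (1 - α)))
    (b := Cl + H + μ) (TensorReg.continuous_objective hρ hL) hcoer hKL
    (mul_pos (by linarith) (lt_min hη0 hc)) ?_ (fun k => ?_) (fun k => ?_)
  · have : 0 < H := hη0.trans_le (le_max_left _ _)
    linarith
  · rcases hB.iteration_or_stopped k with ⟨W, -, m, -, -, hs, -⟩ | ⟨hfix, -⟩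
    · refine le_trans ?_ hs
      have := mul_le_mul_of_nonneg_right (hpos k) (sq_nonneg ‖B (k + 1) - B k‖)
      nlinarith
    · simp [hfix]
  · have hit : ∀ l, TensorReg.IsIteration L ρ κ α η₀ ηmin B η l →
        ∃ v ∈ TensorReg.frechetSubdiff (TensorReg.objective L ρ) (B (l + 1)),
          ‖v‖ ≤ (Cl + H + μ) * ‖B (l + 1) - B l‖ := by
      intro l hl
      have hlH := hbound l hl
      obtain ⟨W, hW, m, -, hu, -, -⟩ := hl
      obtain ⟨v, hv, hvn⟩ := hu.exists_frechetSubdiff hρ hC hμ0 hμ hL hLip (hηpos l) hW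
      exact ⟨v, hv, hvn.trans (by gcongr)⟩
    rcases hB.iteration_or_stopped k with hk | ⟨hfix, l, hl, hlk, heq⟩
    · exact hit k hk
    -- The iteration `l` that stopped made a zero step, so its bound forces `v = 0`, and this
    -- subgradient serves at every later index.
    · obtain ⟨v, hv, hvn⟩ := hit l hl
      rw [hlk, sub_self, norm_zero, mul_zero] at hvn
      exact ⟨v, by rw [← heq]; exact hv, by simpa [hfix] using hvn⟩
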